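/- Let $n\ge 1$ and let $\tau\in\mathbb C^*$ be not a root of unity. Let $H_{1,\tau}$ be the double affine Hecke algebra of $GL(n,\mathbb C)$ at $q=1$: the unital associative $\mathbb C$-algebra generated by $T_1,\dots,T_{n-1}$, $X_1^{\pm1},\dots,X_n^{\pm1}$, $\pi^{\pm1}$ with relations $X_iX_j=X_jX_i$; $T_iX_iT_i=X_{i+1}$; $T_iX_j=X_jT_i$ if $j-i\ne 0,1$; $T_iT_j=T_jT_i$ if $|i-j|>1$; $T_iT_{i+1}T_i=T_{i+1}T_iT_{i+1}$; $\pi X_i=X_{i+1}\pi$ ($1\le i\le n-1$); $\pi X_n=X_1\pi$; $\pi T_i=T_{i+1}\pi$ ($1\le i<n-1$); $\pi^nT_j=T_j\pi^n$; $(T_i-\tau)(T_i+\tau^{-1})=0$. Put $Y_1=T_1T_2\cdots T_{n-1}\pi^{-1}$ and $Z=T_1\cdots T_{n-2}T_{n-1}^2T_{n-2}\cdots T_1$ (with $Z=1$ if $n=1$). Let $A^n_\tau\subset H_{1,\tau}$ be the subalgebra generated by $T_1,\dots,T_{n-1}$, and $A^{n-1}_\tau$ the subalgebra generated by $T_2,\dots,T_{n-1}$.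 For an $H_{1,\tau}$-module $V$ let $V^{A^{n-1}_\tau}=\{v\in V: T_iv=\tau v,\ 2\le i\le n-1\}$; it is stable under $X_1^{\pm1}$ and $Y_1^{\pm1}$, and $\bar X_1,\bar Y_1$ denote the restrictions of $X_1,Y_1$ to it. Let $Irrep^{n!}$ be the set of isomorphism classes of finite dimensional irreducible $H_{1,\tau}$-modules that are isomorphic to $A^n_\tau$ as left $A^n_\tau$-modules. For $t\in\mathbb C^*$ and $E=\mathbb C^n$ let $CM'_t$ be the set of $(X,Y,U,W)\in GL(E)\times GL(E)\times E\times E^*$ with $t\,X^{-1}Y^{-1}XY-t^{-1}=U\otimes W$, let $GL(E)$ act on it by $g\cdot(X,Y,U,W)=(gXg^{-1},gYg^{-1},gU,Wg^{-1})$, and let $CM_t=CM'_t/GL(E)$ be the set of orbits. Then: 1. In $H_{1,\tau}$ one has $Y_1X_1Y_1^{-1}X_1^{-1}=Z$; equivalently, $X_1Y_1X_1^{-1}Y_1^{-1}=Z^{-1}$. 2. For every $V\in Irrep^{n!}$, $\dim V^{A^{n-1}_\tau}=n$ and $$\mathrm{rk}(\bar Y_1\bar X_1\bar Y_1^{-1}\bar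 X_1^{-1}-\tau^{-2}\,\mathrm{Id})=1,\qquad \mathrm{rk}(\bar X_1\bar Y_1\bar X_1^{-1}\bar Y_1^{-1}-\tau^{2}\,\mathrm{Id})=1 .$$ 3. The assignment $V\mapsto(\bar Y_1,\bar X_1)$ gives a well-defined map $\Phi: Irrep^{n!}\to CM_\tau$; likewise $V\mapsto(\bar X_1,\bar Y_1)$ gives a well-defined map $Irrep^{n!}\to CM_{\tau^{-1}}$. That is, for every $V$ and every basis of $V^{A^{n-1}_\tau}$ the matrices of the two operators, in the given order, extend to a point $(X,Y,U,W)$ of $CM'_\tau$ (respectively $CM'_{\tau^{-1}}$), and there is exactly one map from $Irrep^{n!}$ to the orbit space that sends the class of $V$ to the orbit of $(X,Y,U,W)$ for every choice of module $V$ in the class, of the basis and of $U,W$. -/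

import Mathlib

universe u

/-- The generators `T_1, …, T_{n-1}`, `X_1^{±1}, …, X_n^{±1}`, `π^{±1}` of the double affine Hecke
algebra. Indices start at `0`: `T i`, `X i` with value `i.val = k` stand for `T_{k+1}`, `X_{k+1}`. -/
inductive DahaGen (n : ℕ) : Type
  | T (i : Fin (n - 1))
  | X (i : Fin n)
  | Xinv (i : Fin n)
  | pi
  | piInv

namespace DahaGen

/-- The generators, as elements of the free algebra. -/
abbrev t {n : ℕ} (i : Fin (n - 1)) : FreeAlgebra ℂ (DahaGen n) := FreeAlgebra.ι ℂ (T i)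
/-- The generator `X_i` in the free algebra. -/
abbrev x {n : ℕ} (i : Fin n) : FreeAlgebra ℂ (DahaGen n) := FreeAlgebra.ι ℂ (X i)
/-- The generator `X_i^{-1}` in the free algebra. -/
abbrev x' {n : ℕ} (i : Fin n) : FreeAlgebra ℂ (DahaGen n) := FreeAlgebra.ι ℂ (Xinv i)
/-- The generator `π` in the free algebra. -/
abbrev p {n : ℕ} : FreeAlgebra ℂ (DahaGen n) := FreeAlgebra.ι ℂ pi
/-- The generator `π^{-1}` in the free algebra. -/
abbrev p' {n : ℕ} : FreeAlgebra ℂ (DahaGen n) := FreeAlgebra.ι ℂ piInv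

end DahaGen

open DahaGen in
/-- The defining relations of the double affine Hecke algebra `H_{q,τ}` of `GL(n, ℂ)`. -/
inductive DahaRel (n : ℕ) (q τ : ℂˣ) :
    FreeAlgebra ℂ (DahaGen n) → FreeAlgebra ℂ (DahaGen n) → Prop
  | x_mul_inv (i : Fin n) : DahaRel n q τ (x i * x' i) 1
  | inv_mul_x (i : Fin n) : DahaRel n q τ (x' i * x i) 1
  | p_mul_inv : DahaRel n q τ (p * p') 1
  | inv_mul_p : DahaRel n q τ (p' * p) 1
  | x_comm (i j : Fin n) : DahaRel n q τ (x i * x j) (x j * x i)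
  | txt (i : Fin (n - 1)) (j k : Fin n) (hj : j.val = i.val) (hk : k.val = i.val + 1) :
      DahaRel n q τ (t i * x j * t i) (x k)
  | tx_comm (i : Fin (n - 1)) (j : Fin n) (h₀ : j.val ≠ i.val) (h₁ : j.val ≠ i.val + 1) :
      DahaRel n q τ (t i * x j) (x j * t i)
  | tt_comm (i j : Fin (n - 1)) (h : i.val + 1 < j.val ∨ j.val + 1 < i.val) :
      DahaRel n q τ (t i * t j) (t j * t i)
  | braid (i j : Fin (n - 1)) (h : j.val = i.val + 1) :
      DahaRel n q τ (t i * t j * t i) (t j * t i * t j)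
  | px (i j : Fin n) (h : j.val = i.val + 1) : DahaRel n q τ (p * x i) (x j * p)
  | px_last (i j : Fin n) (hi : i.val + 1 = n) (hj : j.val = 0) :
      DahaRel n q τ (p * x i) ((q : ℂ)⁻¹ • (x j * p))
  | pt (i j : Fin (n - 1)) (h : j.val = i.val + 1) : DahaRel n q τ (p * t i) (t j * p)
  | pn_t (j : Fin (n - 1)) : DahaRel n q τ (p ^ n * t j) (t j * p ^ n)
  | quad (i : Fin (n - 1)) :
      DahaRel n q τ ((t i - algebraMap ℂ _ (τ : ℂ)) * (t i + algebraMap ℂ _ (τ : ℂ)⁻¹)) 0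

/-- The double affine Hecke algebra `H_{q,τ}` of `GL(n, ℂ)`. -/
def Daha (n : ℕ) (q τ : ℂˣ) : Type := RingQuot (DahaRel n q τ)

namespace Daha

noncomputable instance (n : ℕ) (q τ : ℂˣ) : Ring (Daha n q τ) :=
  inferInstanceAs (Ring (RingQuot (DahaRel n q τ)))

noncomputable instance (n : ℕ) (q τ : ℂˣ) : Algebra ℂ (Daha n q τ) :=
  inferInstanceAs (Algebra ℂ (RingQuot (DahaRel n q τ)))

variable {n : ℕ} {q τ : ℂˣ}

/-- The quotient map from the free algebra. -/
noncomputable def mk (n : ℕ) (q τ : ℂˣ) : FreeAlgebra ℂ (DahaGen n) →ₐ[ℂ] Daha n q τ :=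
  RingQuot.mkAlgHom ℂ (DahaRel n q τ)

theorem mk_rel {a b : FreeAlgebra ℂ (DahaGen n)} (h : DahaRel n q τ a b) :
    mk n q τ a = mk n q τ b :=
  RingQuot.mkAlgHom_rel ℂ h

/-- `X_i`, as an invertible element of `H_{q,τ}`. -/
noncomputable def X (i : Fin n) : (Daha n q τ)ˣ where
  val := mk n q τ (DahaGen.x i)
  inv := mk n q τ (DahaGen.x' i)
  val_inv := by rw [← map_mul, mk_rel (.x_mul_inv i), map_one]
  inv_val := by rw [← map_mul, mk_rel (.inv_mul_x i), map_one]

/-- `π`, as an invertible element of `H_{q,τ}`. -/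
noncomputable def pi : (Daha n q τ)ˣ where
  val := mk n q τ DahaGen.p
  inv := mk n q τ DahaGen.p'
  val_inv := by rw [← map_mul, mk_rel .p_mul_inv, map_one]
  inv_val := by rw [← map_mul, mk_rel .inv_mul_p, map_one]

theorem quad_eq (i : Fin (n - 1)) :
    mk n q τ (DahaGen.t i) * mk n q τ (DahaGen.t i)
      = (τ - (τ : ℂ)⁻¹) • mk n q τ (DahaGen.t i) + 1 := by
  have h := mk_rel (q := q) (τ := τ) (.quad i)
  simp only [map_mul, map_sub, map_add, AlgHom.commutes, map_zero] at h
  rw [Algebra.algebraMap_eq_smul_one, Algebra.algebraMap_eq_smul_one] at h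
  simp only [sub_mul, mul_add, smul_mul_assoc, one_mul, mul_smul_comm, mul_one, smul_sub,
    smul_smul] at h
  rw [inv_mul_cancel₀ τ.ne_zero, one_smul] at h
  rw [← sub_eq_zero, ← h, sub_smul]
  abel

/-- `T_i`, as an invertible element of `H_{q,τ}`, with inverse `T_i - (τ - τ⁻¹)`. -/
noncomputable def T (i : Fin (n - 1)) : (Daha n q τ)ˣ where
  val := mk n q τ (DahaGen.t i)
  inv := mk n q τ (DahaGen.t i) - (τ - (τ : ℂ)⁻¹) • 1
  val_inv := by rw [mul_sub, quad_eq]; simp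
  inv_val := by rw [sub_mul, quad_eq]; simp

/-- The product `T_1 T_2 ⋯ T_{n-1}`. -/
noncomputable def prodT : (Daha n q τ)ˣ := (List.ofFn fun i : Fin (n - 1) => T i).prod

/-- `Y_1 = T_1 T_2 ⋯ T_{n-1} π⁻¹`. -/
noncomputable def Y₁ : (Daha n q τ)ˣ := prodT * pi⁻¹

/-- `X_1`. -/
noncomputable def X₁ [NeZero n] : (Daha n q τ)ˣ := X 0

/-- `Z = T_1 ⋯ T_{n-2} T_{n-1}² T_{n-2} ⋯ T_1`, written as
`(T_1 ⋯ T_{n-2} T_{n-1}) (T_{n-1} T_{n-2} ⋯ T_1)` (it is `1` for `n = 1`). -/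
noncomputable def Z : (Daha n q τ)ˣ :=
  (List.ofFn fun i : Fin (n - 1) => T i).prod * (List.ofFn fun i : Fin (n - 1) => T i).reverse.prod

/-- The finite Hecke algebra `A^n_τ`: the subalgebra generated by `T_1, …, T_{n-1}`. -/
noncomputable def finiteHecke (n : ℕ) (q τ : ℂˣ) : Subalgebra ℂ (Daha n q τ) :=
  Algebra.adjoin ℂ (Set.range fun i : Fin (n - 1) => ((T i : (Daha n q τ)ˣ) : Daha n q τ))

/-! ### `X_1` and `Y_1` commute with `T_2, …, T_{n-1}` -/

theorem X₁_comm [NeZero n] (i : Fin (n - 1)) (hi : 0 < i.val) :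
    Commute (X₁ : (Daha n q τ)ˣ) (T i) := by
  have h := mk_rel (q := q) (τ := τ) (.tx_comm i (0 : Fin n) (by simp; omega) (by simp))
  rw [map_mul, map_mul] at h
  exact Units.ext h.symm

theorem braid_prod {M : Type*} [Monoid M] (m : ℕ) (t : Fin m → M)
    (hb : ∀ i j : Fin m, j.val = i.val + 1 → t i * t j * t i = t j * t i * t j)
    (hc : ∀ i j : Fin m, i.val + 1 < j.val → t i * t j = t j * t i)
    (i j : Fin m) (h : j.val = i.val + 1) :
    (List.ofFn t).prod * t i = t j * (List.ofFn t).prod := by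
  induction m with
  | zero => exact i.elim0
  | succ m ih =>
    have ih' := ih (fun k => t k.castSucc) (fun a b hab => hb _ _ (by simpa using hab))
      (fun a b hab => hc _ _ (by simpa using hab))
    rw [List.ofFn_succ', List.concat_eq_append, List.prod_append, List.prod_singleton]
    by_cases hj : j.val = m
    · obtain rfl : j = Fin.last m := Fin.ext hj
      obtain ⟨k, rfl⟩ : ∃ k, m = k + 1 := ⟨i.val, by simpa using h⟩
      have hi : i = (Fin.last k).castSucc := Fin.ext (by simpa using h.symm)
      subst hi
      rw [List.ofFn_succ', List.concat_eq_append, List.prod_append, List.prod_singleton]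
      have hcom : Commute (List.ofFn fun a : Fin k => t a.castSucc.castSucc).prod
          (t (Fin.last (k + 1))) := by
        apply Commute.list_prod_left
        intro y hy
        obtain ⟨a, rfl⟩ := (List.mem_ofFn' _ _).1 hy
        exact hc _ _ (by simp)
      have hbr := hb (Fin.last k).castSucc (Fin.last (k + 1)) (by simp)
      rw [mul_assoc, mul_assoc, ← mul_assoc (t _) (t _) (t _), hbr, ← mul_assoc, ← mul_assoc,
        hcom.eq]
      simp only [mul_assoc]
    · have hjm : j.val < m := by have := j.isLt; omega
      have him : i.val < m := by omega
      have e := ih' ⟨i.val, him⟩ ⟨j.val, hjm⟩ h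
      have hcom := hc i (Fin.last m) (by simp; omega)
      rw [mul_assoc, ← hcom, ← mul_assoc]
      change _ * t (Fin.castSucc ⟨i.val, him⟩) * _ = t (Fin.castSucc ⟨j.val, hjm⟩) * _
      rw [e, mul_assoc]

theorem Y₁_comm (j : Fin (n - 1)) (hj : 0 < j.val) : Commute (Y₁ : (Daha n q τ)ˣ) (T j) := by
  have hjlt := j.isLt
  let i : Fin (n - 1) := ⟨j.val - 1, by omega⟩
  have hij : j.val = i.val + 1 := by simp only [i]; omega
  have h1 : (prodT : (Daha n q τ)ˣ) * T i = T j * prodT := by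
    refine braid_prod (n - 1) _ ?_ ?_ i j hij
    · intro a b hab
      have h := mk_rel (q := q) (τ := τ) (.braid a b hab)
      simp only [map_mul] at h
      exact Units.ext h
    · intro a b hab
      have h := mk_rel (q := q) (τ := τ) (.tt_comm a b (Or.inl hab))
      simp only [map_mul] at h
      exact Units.ext h
  have h2 : (pi : (Daha n q τ)ˣ) * T i = T j * pi := by
    have h := mk_rel (q := q) (τ := τ) (.pt i j hij)
    simp only [map_mul] at h
    exact Units.ext h
  have h3 : (pi : (Daha n q τ)ˣ)⁻¹ * T j = T i * pi⁻¹ := by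
    rw [inv_mul_eq_iff_eq_mul, ← mul_assoc, h2, mul_inv_cancel_right]
  change prodT * pi⁻¹ * T j = T j * (prodT * pi⁻¹)
  rw [mul_assoc, h3, ← mul_assoc, h1, mul_assoc]

/-! ### The invariants of `A^{n-1}_τ` and the restricted operators -/

section Invariants

variable (n q τ) (V : Type u) [AddCommGroup V] [Module ℂ V] [Module (Daha n q τ) V]
  [IsScalarTower ℂ (Daha n q τ) V]

/-- The space of `A^{n-1}_τ`-invariants of an `H_{q,τ}`-module: the vectors `v` with `T_i v = τ v`
for all generators `T_2, …, T_{n-1}` of `A^{n-1}_τ`. -/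
def invariants : Submodule ℂ V where
  carrier := {v | ∀ i : Fin (n - 1), 0 < i.val →
    ((T i : (Daha n q τ)ˣ) : Daha n q τ) • v = (τ : ℂ) • v}
  zero_mem' := by intro i _; simp
  add_mem' := by intro v w hv hw i hi; rw [smul_add, smul_add, hv i hi, hw i hi]
  smul_mem' := by
    intro c v hv i hi
    rw [← algebraMap_smul (Daha n q τ) c v, smul_smul, ← Algebra.commutes, ← smul_smul, hv i hi,
      algebraMap_smul, algebraMap_smul, smul_comm]

variable {n q τ}

theorem smul_mem_invariants (g : (Daha n q τ)ˣ)
    (hg : ∀ i : Fin (n - 1), 0 < i.val → Commute g (T i)) {v : V} (hv : v ∈ invariants n q τ V) :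
    (g : Daha n q τ) • v ∈ invariants n q τ V := by
  intro i hi
  have h : ((T i : (Daha n q τ)ˣ) : Daha n q τ) * g = g * (T i : (Daha n q τ)ˣ) := by
    exact_mod_cast congrArg Units.val (hg i hi).eq.symm
  rw [smul_smul, h, ← smul_smul, hv i hi, ← algebraMap_smul (Daha n q τ) (τ : ℂ) v, smul_smul,
    ← Algebra.commutes, ← smul_smul, algebraMap_smul]

/-- The restriction to the `A^{n-1}_τ`-invariants of the action of an invertible element of
`H_{q,τ}` that commutes with `T_2, …, T_{n-1}`. -/
noncomputable def restrict (g : (Daha n q τ)ˣ) (hg : ∀ i : Fin (n - 1), 0 < i.val → Commute g (T i)) :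
    invariants n q τ V ≃ₗ[ℂ] invariants n q τ V where
  toFun v := ⟨(g : Daha n q τ) • (v : V), smul_mem_invariants V g hg v.2⟩
  invFun v := ⟨((g⁻¹ : (Daha n q τ)ˣ) : Daha n q τ) • (v : V),
    smul_mem_invariants V g⁻¹ (fun i hi => (hg i hi).inv_left) v.2⟩
  map_add' v w := Subtype.ext (smul_add _ _ _)
  map_smul' c v := Subtype.ext <| by
    change (g : Daha n q τ) • (c • (v : V)) = c • ((g : Daha n q τ) • (v : V))
    rw [← algebraMap_smul (Daha n q τ) c (v : V), smul_smul, ← Algebra.commutes, ← smul_smul,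
      algebraMap_smul]
  left_inv v := Subtype.ext <| by simp [smul_smul]
  right_inv v := Subtype.ext <| by simp [smul_smul]

/-- `X̄_1`, the restriction of `X_1` to the `A^{n-1}_τ`-invariants. -/
noncomputable def Xbar [NeZero n] : invariants n q τ V ≃ₗ[ℂ] invariants n q τ V :=
  restrict V X₁ X₁_comm

/-- `Ȳ_1`, the restriction of `Y_1` to the `A^{n-1}_τ`-invariants. -/
noncomputable def Ybar : invariants n q τ V ≃ₗ[ℂ] invariants n q τ V :=
  restrict V Y₁ Y₁_comm

end Invariants

end Daha

/-- A finite dimensional irreducible `H_{1,τ}`-module that is regular over `A^n_τ`, i.e. isomorphic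
to `A^n_τ` as a left `A^n_τ`-module. -/
structure RegularIrrep (n : ℕ) (τ : ℂˣ) : Type (u + 1) where
  /-- The underlying space. -/
  V : Type u
  [addCommGroup : AddCommGroup V]
  [moduleC : Module ℂ V]
  [moduleH : Module (Daha n 1 τ) V]
  [tower : IsScalarTower ℂ (Daha n 1 τ) V]
  finite : Module.Finite ℂ V
  simple : IsSimpleModule (Daha n 1 τ) V
  regular : Nonempty (V ≃ₗ[Daha.finiteHecke n 1 τ] Daha.finiteHecke n 1 τ)

namespace RegularIrrep

attribute [instance] addCommGroup moduleC moduleH tower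

variable {n : ℕ} {τ : ℂˣ}

/-- Isomorphism of `H_{1,τ}`-modules. -/
instance setoid (n : ℕ) (τ : ℂˣ) : Setoid (RegularIrrep.{u} n τ) where
  r M N := Nonempty (M.V ≃ₗ[Daha n 1 τ] N.V)
  iseqv := ⟨fun _ => ⟨.refl _ _⟩, fun ⟨e⟩ => ⟨e.symm⟩, fun ⟨e⟩ ⟨f⟩ => ⟨e.trans f⟩⟩

/-- The space of `A^{n-1}_τ`-invariants of the module. -/
abbrev inv (M : RegularIrrep.{u} n τ) : Submodule ℂ M.V := Daha.invariants n 1 τ M.V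

/-- The operator `X̄_1`. -/
noncomputable abbrev Xbar [NeZero n] (M : RegularIrrep.{u} n τ) : M.inv ≃ₗ[ℂ] M.inv :=
  Daha.Xbar M.V

/-- The operator `Ȳ_1`. -/
noncomputable abbrev Ybar (M : RegularIrrep.{u} n τ) : M.inv ≃ₗ[ℂ] M.inv :=
  Daha.Ybar M.V

end RegularIrrep

/-- `Irrep^{n!}`: the set of isomorphism classes of finite dimensional irreducible
`H_{1,τ}`-modules that are regular over `A^n_τ`. -/
def IrrepReg (n : ℕ) (τ : ℂˣ) : Type (u + 1) := Quotient (RegularIrrep.setoid.{u} n τ)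

/-- The class of a module in `Irrep^{n!}`. -/
def RegularIrrep.cls {n : ℕ} {τ : ℂˣ} (M : RegularIrrep.{u} n τ) : IrrepReg.{u} n τ :=
  Quotient.mk _ M

open Matrix in
/-- `CM'_τ`: quadruples `(X, Y, U, V)` in `GL(E) × GL(E) × E × E^*`, `E = ℂⁿ`, with
`τ X⁻¹ Y⁻¹ X Y - τ⁻¹ = U ⊗ V`. Elements of `E^*` are row vectors. -/
@[ext]
structure CMQuad (n : ℕ) (τ : ℂˣ) : Type where
  X : GL (Fin n) ℂ
  Y : GL (Fin n) ℂ
  U : Fin n → ℂ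
  V : Fin n → ℂ
  eqn : (τ : ℂ) • ((X⁻¹ * Y⁻¹ * X * Y : GL (Fin n) ℂ) : Matrix (Fin n) (Fin n) ℂ)
      - (τ : ℂ)⁻¹ • (1 : Matrix (Fin n) (Fin n) ℂ) = vecMulVec U V

open Matrix in
/-- The action `g (X, Y, U, V) = (g X g⁻¹, g Y g⁻¹, g U, V g⁻¹)` of `GL(E)` on `CM'_τ`. -/
noncomputable instance CMQuad.mulAction (n : ℕ) (τ : ℂˣ) :
    MulAction (GL (Fin n) ℂ) (CMQuad n τ) where
  smul g a :=
    { X := g * a.X * g⁻¹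
      Y := g * a.Y * g⁻¹
      U := (g : Matrix (Fin n) (Fin n) ℂ) *ᵥ a.U
      V := a.V ᵥ* ((g⁻¹ : GL (Fin n) ℂ) : Matrix (Fin n) (Fin n) ℂ)
      eqn := by
        have h : (g * a.X * g⁻¹)⁻¹ * (g * a.Y * g⁻¹)⁻¹ * (g * a.X * g⁻¹) * (g * a.Y * g⁻¹)
            = g * (a.X⁻¹ * a.Y⁻¹ * a.X * a.Y) * g⁻¹ := by group
        have h1 : (g : Matrix (Fin n) (Fin n) ℂ) * ((g⁻¹ : GL (Fin n) ℂ) : Matrix _ _ ℂ) = 1 :=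
          Units.mul_inv g
        rw [h, ← vecMulVec_mul, ← mul_vecMulVec, ← a.eqn, Units.val_mul, Units.val_mul]
        rw [Matrix.mul_sub, Matrix.sub_mul, Matrix.mul_smul, Matrix.mul_smul, Matrix.smul_mul,
          Matrix.smul_mul, Matrix.mul_one, h1] }
  one_smul a := by
    apply CMQuad.ext
    · change 1 * a.X * 1⁻¹ = a.X; simp
    · change 1 * a.Y * 1⁻¹ = a.Y; simp
    · change ((1 : GL (Fin n) ℂ) : Matrix (Fin n) (Fin n) ℂ) *ᵥ a.U = a.U; simp
    · change a.V ᵥ* ((1⁻¹ : GL (Fin n) ℂ) : Matrix (Fin n) (Fin n) ℂ) = a.V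
      rw [inv_one]; simp
  mul_smul g h a := by
    apply CMQuad.ext
    · change g * h * a.X * (g * h)⁻¹ = g * (h * a.X * h⁻¹) * g⁻¹; group
    · change g * h * a.Y * (g * h)⁻¹ = g * (h * a.Y * h⁻¹) * g⁻¹; group
    · change ((g * h : GL (Fin n) ℂ) : Matrix (Fin n) (Fin n) ℂ) *ᵥ a.U
        = (g : Matrix (Fin n) (Fin n) ℂ) *ᵥ ((h : Matrix (Fin n) (Fin n) ℂ) *ᵥ a.U)
      rw [Units.val_mul, Matrix.mulVec_mulVec]
    · change a.V ᵥ* (((g * h)⁻¹ : GL (Fin n) ℂ) : Matrix (Fin n) (Fin n) ℂ)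
        = (a.V ᵥ* ((h⁻¹ : GL (Fin n) ℂ) : Matrix (Fin n) (Fin n) ℂ))
          ᵥ* ((g⁻¹ : GL (Fin n) ℂ) : Matrix (Fin n) (Fin n) ℂ)
      rw [_root_.mul_inv_rev, Units.val_mul, Matrix.vecMul_vecMul]

/-- The (set of points of the) Calogero–Moser space `CM_τ = CM'_τ / GL(E)`. -/
noncomputable def CMSpace (n : ℕ) (τ : ℂˣ) : Type := MulAction.orbitRel.Quotient (GL (Fin n) ℂ) (CMQuad n τ)

/-- The class in `CM_τ` of a point of `CM'_τ`. -/
noncomputable def CMQuad.cls {n : ℕ} {τ : ℂˣ} (a : CMQuad n τ) : CMSpace n τ :=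
  Quotient.mk (MulAction.orbitRel (GL (Fin n) ℂ) (CMQuad n τ)) a

/-- The point `a = (X, Y, U, V)` of `CM'_τ` has as `X` and `Y` the matrices of the operators
`A` and `B` in the basis `b`. -/
def CMQuad.Represents {n : ℕ} {τ : ℂˣ} {W : Type*} [AddCommGroup W] [Module ℂ W]
    (a : CMQuad n τ) (b : Module.Basis (Fin n) ℂ W) (A B : W ≃ₗ[ℂ] W) : Prop :=
  (a.X : Matrix (Fin n) (Fin n) ℂ) = LinearMap.toMatrix b b A.toLinearMap ∧
    (a.Y : Matrix (Fin n) (Fin n) ℂ) = LinearMap.toMatrix b b B.toLinearMap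

/-- The rank of `A - c · Id`. -/
noncomputable def rankSubScalar {W : Type*} [AddCommGroup W] [Module ℂ W]
    (A : W ≃ₗ[ℂ] W) (c : ℂ) : ℕ :=
  Module.finrank ℂ (LinearMap.range (A.toLinearMap - c • LinearMap.id))

/-! ### Families satisfying the Hecke relations -/

/-! The commutator identity is a computation with units: at q = 1 conjugation gives π⁻¹ X₁ π = X_n,
and X_n is X₁ multiplied on both sides by products of the T_i, which recombine to Z.

For the rest, regularity reduces everything to the finite Hecke algebra A. An A-isomorphism V ≅ A
carries the invariants to the right ideal eA, where e is the symmetrizer of T_2, …, T_{n-1}; it is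
spanned by the n elements e T_1⋯T_j, 0 ≤ j ≤ n-1. Since Z is a commutator of X₁ and Y₁, it commutes
with e, and the quadratic relation gives eZ - τ⁻² e = τ⁻¹(τ - τ⁻¹) s with s = e ∑ τ^j T_1⋯T_j. Right
multiplication by A only scales s, so Z - τ⁻² maps eA onto the line ℂs
(`mul_ascProd_mul_descProd_sub`, `mul_cosetSum_mul_mem_span`).

What remains is s ≠ 0 and the independence of the n spanning elements. Multiplying a linear relation
by T_i - τ forces its coefficients to be geometric, which leaves a multiple of s, provided e T_1 ≠ τ
e (`linearIndependent_mul_ascProd`). Both non-vanishing statements are tested on the constant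
function in the Demazure–Lusztig representation, so no basis theorem for H is needed.

Finally, a nonzero U ⊗ W determines U and W up to (cU, c⁻¹W), and scalar matrices realise this
freedom while fixing X and Y; hence the orbit depends only on the two operators. -/

section Hecke

/-- The product `t 0 * t 1 * ⋯ * t (j - 1)`. -/
def ascProd {M : Type*} [Monoid M] (t : ℕ → M) : ℕ → M
  | 0 => 1
  | j + 1 => ascProd t j * t j

theorem ascProd_succ {M : Type*} [Monoid M] (t : ℕ → M) (j : ℕ) :
    ascProd t (j + 1) = ascProd t j * t j := rfl

/-- The product `t (j - 1) * ⋯ * t 1 * t 0`. -/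
def descProd {M : Type*} [Monoid M] (t : ℕ → M) : ℕ → M
  | 0 => 1
  | j + 1 => t j * descProd t j

theorem prod_ofFn_eq_ascProd {M : Type*} [Monoid M] (t : ℕ → M) (m : ℕ) :
    (List.ofFn fun i : Fin m => t i).prod = ascProd t m := by
  induction m with
  | zero => simp [ascProd]
  | succ m ih =>
    rw [List.ofFn_succ', List.concat_eq_append, List.prod_append, List.prod_singleton]
    simp [ascProd, ← ih]

theorem prod_reverse_ofFn_eq_descProd {M : Type*} [Monoid M] (t : ℕ → M) (m : ℕ) :
    (List.ofFn fun i : Fin m => t i).reverse.prod = descProd t m := by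
  induction m with
  | zero => simp [descProd]
  | succ m ih =>
    rw [List.ofFn_succ', List.concat_eq_append, List.reverse_append, List.prod_append]
    simp [descProd, ← ih]

theorem map_ascProd {M N F : Type*} [Monoid M] [Monoid N] [FunLike F M N] [MonoidHomClass F M N]
    (f : F) (t : ℕ → M) (j : ℕ) : f (ascProd t j) = ascProd (fun i => f (t i)) j := by
  induction j with
  | zero => exact map_one f
  | succ j ih => rw [ascProd, ascProd, map_mul, ih]

theorem map_descProd {M N F : Type*} [Monoid M] [Monoid N] [FunLike F M N] [MonoidHomClass F M N]
    (f : F) (t : ℕ → M) (j : ℕ) : f (descProd t j) = descProd (fun i => f (t i)) j := by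
  induction j with
  | zero => exact map_one f
  | succ j ih => rw [descProd, descProd, map_mul, ih]

theorem ascProd_smul {K R M : Type*} [Field K] [Ring R] [AddCommGroup M] [Module K M] [Module R M]
    [SMulCommClass R K M] {τ : K} {m : ℕ} {t : ℕ → R} {v : M} (hv : ∀ i < m, t i • v = τ • v) {j : ℕ} (hj : j ≤ m) :
    ascProd t j • v = τ ^ j • v := by
  induction j with
  | zero => simp [ascProd]
  | succ j ih =>
    rw [ascProd, mul_smul, hv j (by omega), smul_comm, ih (by omega), smul_smul, pow_succ']

variable {K R : Type*} [Field K] [Ring R] [Algebra K R]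

/-- The elements `t 0, …, t (m - 1)` of `R` satisfy the relations of the finite Hecke algebra of
type `A_m` with parameter `τ`. -/
structure IsHeckeFamily (τ : K) (m : ℕ) (t : ℕ → R) : Prop where
  quad : ∀ i < m, t i * t i = (τ - τ⁻¹) • t i + 1
  braid : ∀ i, i + 1 < m → t i * t (i + 1) * t i = t (i + 1) * t i * t (i + 1)
  comm : ∀ i j, i + 1 < j → j < m → t i * t j = t j * t i

namespace IsHeckeFamily

variable {τ : K} {m : ℕ} {t : ℕ → R}

theorem shift (h : IsHeckeFamily τ m t) : IsHeckeFamily τ (m - 1) (fun i => t (i + 1)) where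
  quad i hi := h.quad _ (by omega)
  braid i hi := h.braid _ (by omega)
  comm i j hij hj := h.comm _ _ (by omega) (by omega)

/-- The relations are invariant under reversing words, so statements about right multiplication
transfer to left multiplication. -/
theorem op (h : IsHeckeFamily τ m t) : IsHeckeFamily τ m (fun i => MulOpposite.op (t i)) where
  quad i hi := by simp only [← MulOpposite.op_mul, h.quad i hi]; simp
  braid i hi := by simp only [← MulOpposite.op_mul, ← mul_assoc, h.braid i hi]
  comm i j hij hj := by simp only [← MulOpposite.op_mul, h.comm i j hij hj]

theorem ascProd_mul_of_lt (h : IsHeckeFamily τ m t) {i j : ℕ} (hij : j < i) (hi : i < m) :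
    ascProd t j * t i = t i * ascProd t j := by
  induction j with
  | zero => simp [ascProd]
  | succ j ih =>
    rw [ascProd, mul_assoc, h.comm j i hij hi, ← mul_assoc, ih (by omega), mul_assoc]

/-- A single braid move at the factor `t i * t (i + 1)` raises the index by one; all other factors
commute past. -/
theorem ascProd_mul_of_gt (h : IsHeckeFamily τ m t) {i j : ℕ} (hij : i + 1 < j) (hj : j ≤ m) :
    ascProd t j * t i = t (i + 1) * ascProd t j := by
  induction j with
  | zero => omega
  | succ j ih =>
    by_cases hj' : j = i + 1
    · subst hj'
      rw [ascProd, ascProd, mul_assoc, mul_assoc, ← mul_assoc (t i), h.braid i (by omega),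
        ← mul_assoc, ← mul_assoc, h.ascProd_mul_of_lt (by omega) (by omega)]
      simp only [mul_assoc]
    · rw [ascProd, mul_assoc, ← h.comm i j (by omega) (by omega), ← mul_assoc,
        ih (by omega) (by omega), mul_assoc]

end IsHeckeFamily

/-- `∑_{j ≤ m} τ^j t_0 ⋯ t_{j-1}`, the sum over the minimal length representatives of the cosets of
the parabolic subalgebra generated by `t_1, …, t_{m-1}`. -/
def cosetSum (τ : K) (t : ℕ → R) (m : ℕ) : R := ∑ j ∈ Finset.range (m + 1), τ ^ j • ascProd t j

/-- The (unnormalised) symmetrizer of the Hecke algebra generated by `t_0, …, t_{m-1}`. -/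
def heckeSymm (τ : K) : ℕ → (ℕ → R) → R
  | 0, _ => 1
  | m + 1, t => heckeSymm τ m (fun i => t (i + 1)) * cosetSum τ t (m + 1)

/-- The Poincaré polynomial of the symmetric group on `m + 1` letters at `τ²`. -/
def heckePoincare (τ : K) (m : ℕ) : K :=
  ∏ k ∈ Finset.range m, ∑ j ∈ Finset.range (k + 2), τ ^ (2 * j)

/-- Multiplied by τ² - 1, the sum becomes τ^(2(k+1)) - 1. -/
theorem sum_even_pow_ne_zero {τ : K} (hτ : ∀ k : ℕ, 0 < k → τ ^ k ≠ 1) (k : ℕ) :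
    ∑ j ∈ Finset.range (k + 1), τ ^ (2 * j) ≠ 0 := by
  intro h0
  have h := geom_sum_mul (τ ^ 2) (k + 1)
  simp only [← pow_mul] at h
  rw [h0, zero_mul] at h
  exact hτ (2 * (k + 1)) (by omega) (sub_eq_zero.1 h.symm)

theorem heckePoincare_ne_zero {τ : K} (hτ : ∀ k : ℕ, 0 < k → τ ^ k ≠ 1) (m : ℕ) :
    heckePoincare τ m ≠ 0 :=
  Finset.prod_ne_zero_iff.2 fun k _ => sum_even_pow_ne_zero hτ (k + 1)

/-! ### Action on vectors of the trivial representation -/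

section Action

variable {M : Type*} [AddCommGroup M] [Module K M] [Module R M] [IsScalarTower K R M]
  [SMulCommClass R K M] {τ : K} {m : ℕ} {t : ℕ → R}

theorem cosetSum_smul {v : M} (hv : ∀ i < m, t i • v = τ • v) :
    cosetSum τ t m • v = (∑ j ∈ Finset.range (m + 1), τ ^ (2 * j)) • v := by
  rw [cosetSum, Finset.sum_smul, Finset.sum_smul]
  refine Finset.sum_congr rfl fun j hj => ?_
  rw [smul_assoc, ascProd_smul hv (by simpa [Nat.lt_succ_iff] using hj), smul_smul, ← pow_add,
    two_mul]

/-- Stated for an arbitrary module because it is applied to the algebra, to its opposite and to the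
Demazure–Lusztig representation. -/
theorem heckeSymm_smul {v : M} (hv : ∀ i < m, t i • v = τ • v) :
    heckeSymm τ m t • v = heckePoincare τ m • v := by
  induction m generalizing t with
  | zero => simp [heckeSymm, heckePoincare]
  | succ m ih =>
    rw [heckeSymm, mul_smul, cosetSum_smul hv, smul_comm,
      ih (t := fun i => t (i + 1)) fun i hi => hv (i + 1) (by omega), smul_smul, heckePoincare,
      heckePoincare, Finset.prod_range_succ, mul_comm]

end Action

namespace IsHeckeFamily

variable {τ : K} {m : ℕ} {t : ℕ → R}

/-! ### The right ideal generated by an element invariant under the parabolic subalgebra -/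

section Coset

variable {e : R}

theorem mul_ascProd_mul_of_lt (h : IsHeckeFamily τ m t)
    (he : ∀ i, i + 1 < m → e * t (i + 1) = τ • e) {i j : ℕ} (hij : j < i) (hi : i < m) :
    e * ascProd t j * t i = τ • (e * ascProd t j) := by
  obtain ⟨i, rfl⟩ : ∃ k, i = k + 1 := ⟨i - 1, by omega⟩
  rw [mul_assoc, h.ascProd_mul_of_lt hij hi, ← mul_assoc, he i hi, smul_mul_assoc]

theorem mul_ascProd_mul_of_gt (h : IsHeckeFamily τ m t)
    (he : ∀ i, i + 1 < m → e * t (i + 1) = τ • e) {i j : ℕ} (hij : i + 1 < j) (hj : j ≤ m) :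
    e * ascProd t j * t i = τ • (e * ascProd t j) := by
  rw [mul_assoc, h.ascProd_mul_of_gt hij hj, ← mul_assoc, he i (by omega), smul_mul_assoc]

theorem mul_ascProd_succ_mul (h : IsHeckeFamily τ m t) {i : ℕ} (hi : i < m) :
    e * ascProd t (i + 1) * t i = (τ - τ⁻¹) • (e * ascProd t (i + 1)) + e * ascProd t i := by
  rw [ascProd, mul_assoc, mul_assoc, h.quad i hi, mul_add, mul_add, mul_smul_comm, mul_smul_comm,
    mul_one]

/-- Every `e * ascProd t j` with j ≠ i, i + 1 is an eigenvector of right multiplication by `t i`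
with eigenvalue τ; only the pair j = i, i + 1 survives, and there the quadratic relation applies. -/
theorem mul_ascProd_mul_sub (h : IsHeckeFamily τ m t)
    (hτ : τ ≠ 0) (he : ∀ i, i + 1 < m → e * t (i + 1) = τ • e) {i : ℕ} (hi : i < m) (c : ℕ → K) :
    (∑ j ∈ Finset.range (m + 1), c j • (e * ascProd t j)) * t i
        - τ • ∑ j ∈ Finset.range (m + 1), c j • (e * ascProd t j)
      = (c i - τ⁻¹ * c (i + 1)) • (e * ascProd t (i + 1) - τ • (e * ascProd t i)) := by
  rw [Finset.sum_mul, Finset.smul_sum, ← Finset.sum_sub_distrib]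
  have hsub : ({i, i + 1} : Finset ℕ) ⊆ Finset.range (m + 1) := by
    intro j hj
    simp only [Finset.mem_insert, Finset.mem_singleton] at hj
    rw [Finset.mem_range]; omega
  rw [← Finset.sum_subset hsub, Finset.sum_pair (by omega)]
  · rw [smul_mul_assoc, smul_mul_assoc, h.mul_ascProd_succ_mul hi, mul_assoc, ← ascProd_succ]
    match_scalars <;> field_simp <;> ring
  · intro j hj hj'
    simp only [Finset.mem_insert, Finset.mem_singleton, not_or] at hj'
    rw [Finset.mem_range] at hj
    rw [smul_mul_assoc, sub_eq_zero, smul_comm τ]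
    congr 1
    rcases Nat.lt_or_ge j i with hji | hji
    · exact h.mul_ascProd_mul_of_lt he hji hi
    · exact h.mul_ascProd_mul_of_gt he (by omega) (by omega)

/-- The weights τ^j are exactly those for which the factor `c i - τ⁻¹ * c (i + 1)` vanishes. -/
theorem mul_cosetSum_mul (h : IsHeckeFamily τ m t) (hτ : τ ≠ 0)
    (he : ∀ i, i + 1 < m → e * t (i + 1) = τ • e) {i : ℕ} (hi : i < m) :
    e * cosetSum τ t m * t i = τ • (e * cosetSum τ t m) := by
  have hs := h.mul_ascProd_mul_sub hτ he hi fun j => τ ^ j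
  have h0 : τ ^ i - τ⁻¹ * τ ^ (i + 1) = 0 := by rw [pow_succ']; field_simp; simp
  rw [h0, zero_smul, sub_eq_zero] at hs
  simpa only [cosetSum, Finset.mul_sum, mul_smul_comm] using hs

theorem mul_ascProd_mul_descProd (h : IsHeckeFamily τ m t)
    (he : ∀ i, i + 1 < m → e * t (i + 1) = τ • e) {i j : ℕ} (hij : i < j) (hj : j ≤ m) :
    e * ascProd t j * descProd t i = τ ^ i • (e * ascProd t j) := by
  induction i with
  | zero => simp [descProd]
  | succ i ih =>
    rw [descProd, ← mul_assoc, h.mul_ascProd_mul_of_gt he hij hj, smul_mul_assoc,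
      ih (by omega), smul_smul, pow_succ']

/-- The quadratic relation is applied to the innermost square `t j * t j`. In the resulting term
with `ascProd t (j + 1)`, the factor `descProd t j` only contributes τ^j. -/
theorem mul_ascProd_mul_descProd_self (h : IsHeckeFamily τ m t)
    (he : ∀ i, i + 1 < m → e * t (i + 1) = τ • e) {j : ℕ} (hj : j ≤ m) :
    e * (ascProd t j * descProd t j)
      = e + (τ - τ⁻¹) • ∑ k ∈ Finset.range j, τ ^ k • (e * ascProd t (k + 1)) := by
  induction j with
  | zero => simp [ascProd, descProd]
  | succ j ih =>
    have h1 : ascProd t (j + 1) * descProd t (j + 1)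
        = (τ - τ⁻¹) • (ascProd t (j + 1) * descProd t j) + ascProd t j * descProd t j := by
      rw [ascProd, descProd, mul_assoc, ← mul_assoc (t j), h.quad j (by omega), add_mul, mul_add,
        smul_mul_assoc, mul_smul_comm, one_mul, ← mul_assoc, ← ascProd_succ]
    rw [h1, mul_add, ih (by omega), mul_smul_comm, ← mul_assoc,
      h.mul_ascProd_mul_descProd he (by omega) hj, Finset.sum_range_succ, smul_add]
    abel

theorem mul_ascProd_mul_descProd_sub (h : IsHeckeFamily τ m t) (hτ : τ ≠ 0)
    (he : ∀ i, i + 1 < m → e * t (i + 1) = τ • e) :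
    e * (ascProd t m * descProd t m) - τ⁻¹ ^ 2 • e
      = (τ⁻¹ * (τ - τ⁻¹)) • (e * cosetSum τ t m) := by
  have h1 : e * cosetSum τ t m
      = e + τ • ∑ k ∈ Finset.range m, τ ^ k • (e * ascProd t (k + 1)) := by
    rw [cosetSum, Finset.sum_range_succ', mul_add, Finset.mul_sum, Finset.smul_sum]
    simp only [mul_smul_comm, ascProd, smul_smul, pow_succ']
    simp [add_comm]
  rw [h1, h.mul_ascProd_mul_descProd_self he le_rfl]
  match_scalars <;> field_simp

/-- The span of the elements `e t_0 ⋯ t_{j-1}` is stable under right multiplication by the Hecke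
algebra. -/
theorem mul_mem_span (h : IsHeckeFamily τ m t) (he : ∀ i, i + 1 < m → e * t (i + 1) = τ • e)
    {a : R} (ha : a ∈ Algebra.adjoin K (t '' Set.Iio m)) :
    e * a ∈ Submodule.span K (Set.range fun j : Fin (m + 1) => e * ascProd t j) := by
  set N := Submodule.span K (Set.range fun j : Fin (m + 1) => e * ascProd t j) with hN
  have hmem : ∀ j ≤ m, e * ascProd t j ∈ N := fun j hj =>
    Submodule.subset_span ⟨⟨j, by omega⟩, rfl⟩
  have hst : ∀ i < m, ∀ x ∈ N, x * t i ∈ N := by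
    intro i hi x hx
    induction hx using Submodule.span_induction with
    | mem x hx =>
      obtain ⟨⟨j, hj⟩, rfl⟩ := hx
      simp only
      rcases lt_trichotomy j i with hji | rfl | hji
      · rw [h.mul_ascProd_mul_of_lt he hji hi]
        exact N.smul_mem _ (hmem j (by omega))
      · rw [mul_assoc, ← ascProd_succ]
        exact hmem _ (by omega)
      · by_cases hj' : j = i + 1
        · subst hj'
          rw [h.mul_ascProd_succ_mul hi]
          exact N.add_mem (N.smul_mem _ (hmem _ (by omega))) (hmem _ (by omega))
        · rw [h.mul_ascProd_mul_of_gt he (by omega) (by omega)]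
          exact N.smul_mem _ (hmem j (by omega))
    | zero => simp
    | add x y _ _ hx hy => rw [add_mul]; exact N.add_mem hx hy
    | smul c x _ hx => rw [smul_mul_assoc]; exact N.smul_mem _ hx
  have key : ∀ x ∈ N, x * a ∈ N := by
    induction ha using Algebra.adjoin_induction with
    | mem a ha =>
      obtain ⟨i, hi, rfl⟩ := ha
      exact hst i hi
    | algebraMap r =>
      intro x hx
      rw [← Algebra.commutes, ← Algebra.smul_def]
      exact N.smul_mem _ hx
    | add a b _ _ iha ihb => intro x hx; rw [mul_add]; exact N.add_mem (iha x hx) (ihb x hx)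
    | mul a b _ _ iha ihb => intro x hx; rw [← mul_assoc]; exact ihb _ (iha x hx)
  exact key e (by simpa [ascProd] using hmem 0 (by omega))

theorem mul_cosetSum_mul_mem_span (h : IsHeckeFamily τ m t) (hτ : τ ≠ 0)
    (he : ∀ i, i + 1 < m → e * t (i + 1) = τ • e)
    {a : R} (ha : a ∈ Algebra.adjoin K (t '' Set.Iio m)) :
    ∃ c : K, e * cosetSum τ t m * a = c • (e * cosetSum τ t m) := by
  induction ha using Algebra.adjoin_induction with
  | mem a ha =>
    obtain ⟨i, hi, rfl⟩ := ha
    exact ⟨τ, h.mul_cosetSum_mul hτ he hi⟩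
  | algebraMap r => exact ⟨r, by rw [← Algebra.commutes, ← Algebra.smul_def]⟩
  | add a b _ _ iha ihb =>
    obtain ⟨c, hc⟩ := iha
    obtain ⟨d, hd⟩ := ihb
    exact ⟨c + d, by rw [mul_add, hc, hd, add_smul]⟩
  | mul a b _ _ iha ihb =>
    obtain ⟨c, hc⟩ := iha
    obtain ⟨d, hd⟩ := ihb
    exact ⟨c * d, by rw [← mul_assoc, hc, smul_mul_assoc, hd, smul_smul]⟩

/-- If the difference vanished at i + 1, right multiplication by `t i` would make it vanish at i,
and so on down to `e * t 0 = τ • e`. -/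
theorem mul_ascProd_succ_ne (h : IsHeckeFamily τ m t) (hτ : τ ≠ 0)
    (he : ∀ i, i + 1 < m → e * t (i + 1) = τ • e) (h0 : 0 < m → e * t 0 ≠ τ • e) {i : ℕ}
    (hi : i < m) : e * ascProd t (i + 1) - τ • (e * ascProd t i) ≠ 0 := by
  induction i with
  | zero => simpa [ascProd, sub_eq_zero] using h0 hi
  | succ i ih =>
    intro hz
    apply ih (by omega)
    have h1 := h.mul_ascProd_mul_of_gt he (i := i) (j := i + 1 + 1) (by omega) (by omega)
    have h2 := h.mul_ascProd_succ_mul (e := e) (i := i) (by omega)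
    have h3 := congrArg (· * t i) hz
    simp only [sub_mul, smul_mul_assoc, zero_mul, h1, h2] at h3
    rw [sub_eq_zero.1 hz] at h3
    rw [← h3]
    match_scalars
    · field_simp
      ring
    · ring

/-- The elements `e t_0 ⋯ t_{j-1}`, `j ≤ m`, are linearly independent as soon as neither the trivial
nor the reflection representation is lost. -/
theorem linearIndependent_mul_ascProd (h : IsHeckeFamily τ m t) (hτ : τ ≠ 0)
    (he : ∀ i, i + 1 < m → e * t (i + 1) = τ • e) (h0 : 0 < m → e * t 0 ≠ τ • e)
    (hS : e * cosetSum τ t m ≠ 0) :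
    LinearIndependent K fun j : Fin (m + 1) => e * ascProd t j := by
  rw [Fintype.linearIndependent_iff]
  intro g hg
  -- The coefficients are extended by zero to ℕ, the index set of `mul_ascProd_mul_sub`.
  let c : ℕ → K := fun j => if hj : j < m + 1 then g ⟨j, hj⟩ else 0
  have hc : ∑ j ∈ Finset.range (m + 1), c j • (e * ascProd t j) = 0 := by
    rw [← hg, Finset.sum_range]
    refine Finset.sum_congr rfl fun j _ => ?_
    simp only [c, dif_pos j.isLt]
  -- Right multiplication of the relation by `t i - τ` leaves a multiple of one nonzero vector.
  have hrec : ∀ i < m, c (i + 1) = τ * c i := by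
    intro i hi
    have hs := h.mul_ascProd_mul_sub hτ he hi c
    rw [hc, zero_mul, smul_zero, sub_zero, eq_comm, smul_eq_zero] at hs
    have h1 := hs.resolve_right (h.mul_ascProd_succ_ne hτ he h0 hi)
    rw [sub_eq_zero] at h1
    rw [h1]; field_simp
  have hpow : ∀ j ≤ m, c j = c 0 * τ ^ j := by
    intro j hj
    induction j with
    | zero => simp
    | succ j ih => rw [hrec j (by omega), ih (by omega), pow_succ]; ring
  have hc0 : c 0 = 0 := by
    have h1 : c 0 • (e * cosetSum τ t m) = 0 := by
      rw [← hc, cosetSum, Finset.mul_sum, Finset.smul_sum]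
      refine Finset.sum_congr rfl fun j hj => ?_
      rw [hpow j (by simpa [Nat.lt_succ_iff] using hj), mul_smul_comm, smul_smul]
    exact (smul_eq_zero.1 h1).resolve_right hS
  intro j
  have h2 := hpow j (Nat.lt_succ_iff.1 j.isLt)
  rw [hc0, zero_mul] at h2
  rwa [show c j = g j from dif_pos j.isLt] at h2

end Coset

theorem heckeSymm_mul (h : IsHeckeFamily τ m t) (hτ : τ ≠ 0) {i : ℕ} (hi : i < m) :
    heckeSymm τ m t * t i = τ • heckeSymm τ m t := by
  induction m generalizing t i with
  | zero => omega
  | succ m ih =>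
    exact h.mul_cosetSum_mul hτ (fun k hk => ih h.shift (by omega)) hi

/-- With E the symmetrizer and F its mirror image, E is right invariant and F left invariant. Hence
EF equals both P·F and P·E, where P is the nonzero Poincaré value. Left invariance of E follows. -/
theorem heckeSymm_eq_unop (h : IsHeckeFamily τ m t) (hτ : ∀ k : ℕ, 0 < k → τ ^ k ≠ 1)
    (hτ0 : τ ≠ 0) :
    heckeSymm τ m t = (heckeSymm τ m fun i => MulOpposite.op (t i)).unop := by
  set E := heckeSymm τ m t with hE
  set F := heckeSymm τ m fun i => MulOpposite.op (t i) with hF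
  have h1 : E • F.unop = heckePoincare τ m • F.unop := by
    refine heckeSymm_smul fun i hi => ?_
    have := congrArg MulOpposite.unop (h.op.heckeSymm_mul hτ0 hi)
    simpa using this
  have h2 : F • MulOpposite.op E = heckePoincare τ m • MulOpposite.op E := by
    refine heckeSymm_smul fun i hi => ?_
    have := congrArg MulOpposite.op (h.heckeSymm_mul hτ0 hi)
    simpa using this
  have h3 := congrArg MulOpposite.unop h2
  simp only [smul_eq_mul, MulOpposite.unop_mul, MulOpposite.unop_op, MulOpposite.unop_smul] at h1 h3
  rw [h1] at h3
  exact (smul_right_injective R (heckePoincare_ne_zero hτ m) h3).symm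

theorem mul_heckeSymm (h : IsHeckeFamily τ m t) (hτ : ∀ k : ℕ, 0 < k → τ ^ k ≠ 1)
    (hτ0 : τ ≠ 0) {i : ℕ} (hi : i < m) : t i * heckeSymm τ m t = τ • heckeSymm τ m t := by
  rw [h.heckeSymm_eq_unop hτ hτ0]
  simpa using congrArg MulOpposite.unop (h.op.heckeSymm_mul hτ0 hi)

end IsHeckeFamily

theorem ascProd_mem {S : Subalgebra K R} {t : ℕ → R} {m : ℕ} (ht : ∀ i < m, t i ∈ S) {j : ℕ}
    (hj : j ≤ m) : ascProd t j ∈ S := by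
  induction j with
  | zero => exact S.one_mem
  | succ j ih => exact S.mul_mem (ih (by omega)) (ht j (by omega))

theorem map_heckeSymm {R' : Type*} [Ring R'] [Algebra K R'] (f : R →ₐ[K] R') (τ : K) (m : ℕ)
    (t : ℕ → R) : f (heckeSymm τ m t) = heckeSymm τ m fun i => f (t i) := by
  induction m generalizing t with
  | zero => exact map_one f
  | succ m ih => simp only [heckeSymm, map_mul, ih, cosetSum, map_sum, map_smul, map_ascProd]

theorem map_cosetSum {R' : Type*} [Ring R'] [Algebra K R'] (f : R →ₐ[K] R') (τ : K) (m : ℕ)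
    (t : ℕ → R) : f (cosetSum τ t m) = cosetSum τ (fun i => f (t i)) m := by
  simp only [cosetSum, map_sum, map_smul, map_ascProd]

theorem descProd_mem {S : Subalgebra K R} {t : ℕ → R} {m : ℕ} (ht : ∀ i < m, t i ∈ S) {j : ℕ}
    (hj : j ≤ m) : descProd t j ∈ S := by
  induction j with
  | zero => exact S.one_mem
  | succ j ih => exact S.mul_mem (ht j (by omega)) (ih (by omega))

theorem heckeSymm_mem {S : Subalgebra K R} {τ : K} {t : ℕ → R} {m : ℕ} (ht : ∀ i < m, t i ∈ S) :
    heckeSymm τ m t ∈ S := by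
  induction m generalizing t with
  | zero => exact S.one_mem
  | succ m ih =>
    refine S.mul_mem (ih fun i hi => ht _ (by omega)) (S.sum_mem fun j hj => S.smul_mem ?_ _)
    exact ascProd_mem ht (by simpa [Nat.lt_succ_iff] using hj)

theorem commute_heckeSymm {τ : K} {t : ℕ → R} {m : ℕ} {z : R} (hz : ∀ i < m, Commute z (t i)) :
    Commute z (heckeSymm τ m t) := by
  have h : heckeSymm τ m t ∈ Subalgebra.centralizer K {z} :=
    heckeSymm_mem fun i hi => Subalgebra.mem_centralizer_iff K |>.2 <| by
      rintro _ rfl; exact hz i hi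
  exact (Subalgebra.mem_centralizer_iff K).1 h z rfl

end Hecke
/-! ### The Demazure–Lusztig representation at `q = 1` -/

namespace DemazureLusztig

open Equiv

variable {n : ℕ}

/-- Multiplication of functions on the symmetric group by `w ↦ w(i) + 1`. -/
def opX (i : Fin n) : Module.End ℂ (Perm (Fin n) → ℂ) where
  toFun f w := ((w i : ℕ) + 1 : ℂ) * f w
  map_add' f g := by ext w; simp [mul_add]
  map_smul' c f := by ext w; simp; ring

/-- Multiplication of functions on the symmetric group by `w ↦ (w(i) + 1)⁻¹`. -/
noncomputable def opXinv (i : Fin n) : Module.End ℂ (Perm (Fin n) → ℂ) where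
  toFun f w := ((w i : ℕ) + 1 : ℂ)⁻¹ * f w
  map_add' f g := by ext w; simp [mul_add]
  map_smul' c f := by ext w; simp; ring

/-- Right translation of functions on the symmetric group. -/
def opPerm (g : Perm (Fin n)) : Module.End ℂ (Perm (Fin n) → ℂ) where
  toFun f w := f (w * g)
  map_add' _ _ := rfl
  map_smul' _ _ := rfl

/-- The coefficient of the transposition in a Demazure–Lusztig operator. -/
noncomputable def coeffS (τ : ℂ) (u v : ℕ) : ℂ := (τ * (u + 1) - τ⁻¹ * (v + 1)) / ((u : ℂ) - v)

/-- The coefficient of the identity in a Demazure–Lusztig operator. -/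
noncomputable def coeffOne (τ : ℂ) (u v : ℕ) : ℂ := -((τ - τ⁻¹) * (v + 1)) / ((u : ℂ) - v)

/-- The Demazure–Lusztig operator of the transposition of `i` and `j`. -/
noncomputable def opT (τ : ℂ) (i j : Fin n) : Module.End ℂ (Perm (Fin n) → ℂ) where
  toFun f w := coeffS τ (w i) (w j) * f (w * swap i j) + coeffOne τ (w i) (w j) * f w
  map_add' f g := by ext w; simp; ring
  map_smul' c f := by ext w; simp; ring

theorem cast_sub_ne_zero {u v : ℕ} (h : u ≠ v) : (u : ℂ) - v ≠ 0 := by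
  rw [sub_ne_zero]; exact_mod_cast h

theorem val_apply_ne (w : Perm (Fin n)) {i j : Fin n} (h : i ≠ j) : (w i : ℕ) ≠ w j :=
  fun e => h (w.injective (Fin.ext e))

theorem opT_apply (τ : ℂ) (i j : Fin n) (f : Perm (Fin n) → ℂ) (w : Perm (Fin n)) :
    opT τ i j f w = coeffS τ (w i) (w j) * f (w * swap i j) + coeffOne τ (w i) (w j) * f w := rfl

theorem opX_apply (i : Fin n) (f : Perm (Fin n) → ℂ) (w : Perm (Fin n)) :
    opX i f w = ((w i : ℕ) + 1 : ℂ) * f w := rfl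

theorem opPerm_apply (g : Perm (Fin n)) (f : Perm (Fin n) → ℂ) (w : Perm (Fin n)) :
    opPerm g f w = f (w * g) := rfl

/-- The two coefficients add up to τ, so the constant function spans a copy of the trivial
representation. -/
theorem opT_one {τ : ℂ} (hτ : τ ≠ 0) {i j : Fin n} (h : i ≠ j) : opT τ i j 1 = τ • 1 := by
  ext w
  have h1 := cast_sub_ne_zero (val_apply_ne w h)
  rw [opT_apply, coeffS, coeffOne]
  simp only [Pi.one_apply, Pi.smul_apply, smul_eq_mul, mul_one]
  field_simp
  ring

theorem opT_quad {τ : ℂ} (hτ : τ ≠ 0) {i j : Fin n} (h : i ≠ j) :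
    opT τ i j * opT τ i j = (τ - τ⁻¹) • opT τ i j + 1 := by
  refine LinearMap.ext fun f => funext fun w => ?_
  have h1 := cast_sub_ne_zero (val_apply_ne w h)
  have h2 := cast_sub_ne_zero (val_apply_ne w h).symm
  simp only [Module.End.mul_apply, LinearMap.add_apply, LinearMap.smul_apply, Pi.add_apply,
    Pi.smul_apply, opT_apply, Perm.mul_apply, swap_apply_left, swap_apply_right, mul_assoc,
    swap_mul_self, mul_one, smul_eq_mul, Module.End.one_apply, coeffS, coeffOne]
  generalize f w = a
  generalize f (w * swap i j) = b
  generalize ((w i : ℕ) : ℂ) = u at *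
  generalize ((w j : ℕ) : ℂ) = v at *
  rw [show v - u = -(u - v) by ring]
  field_simp
  ring

theorem opT_mul_opX_mul_opT {τ : ℂ} (hτ : τ ≠ 0) {i j : Fin n} (h : i ≠ j) :
    opT τ i j * opX i * opT τ i j = opX j := by
  refine LinearMap.ext fun f => funext fun w => ?_
  have h1 := cast_sub_ne_zero (val_apply_ne w h)
  have h2 := cast_sub_ne_zero (val_apply_ne w h).symm
  simp only [Module.End.mul_apply, opT_apply, opX_apply, Perm.mul_apply, swap_apply_left,
    swap_apply_right, mul_assoc, swap_mul_self, mul_one, coeffS, coeffOne]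
  generalize f w = a
  generalize f (w * swap i j) = b
  generalize ((w i : ℕ) : ℂ) = u at *
  generalize ((w j : ℕ) : ℂ) = v at *
  rw [show v - u = -(u - v) by ring]
  field_simp
  ring

theorem opT_mul_opX {τ : ℂ} {i j k : Fin n} (hi : k ≠ i) (hj : k ≠ j) :
    opT τ i j * opX k = opX k * opT τ i j := by
  refine LinearMap.ext fun f => funext fun w => ?_
  simp only [Module.End.mul_apply, opT_apply, opX_apply, Perm.mul_apply,
    swap_apply_of_ne_of_ne hi hj]
  ring

theorem opT_comm {τ : ℂ} {i j k l : Fin n} (hij : i ≠ j) (hkl : k ≠ l) (hik : i ≠ k)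
    (hil : i ≠ l) (hjk : j ≠ k) (hjl : j ≠ l) : opT τ i j * opT τ k l = opT τ k l * opT τ i j := by
  refine LinearMap.ext fun f => funext fun w => ?_
  have hs : swap i j * swap k l = swap k l * swap i j :=
    (Perm.disjoint_swap_swap (by simp_all)).commute.eq
  simp only [Module.End.mul_apply, opT_apply, Perm.mul_apply, mul_assoc, hs,
    swap_apply_of_ne_of_ne hik hil, swap_apply_of_ne_of_ne hjk hjl,
    swap_apply_of_ne_of_ne hik.symm hjk.symm, swap_apply_of_ne_of_ne hil.symm hjl.symm]
  ring

theorem opT_braid {τ : ℂ} (hτ : τ ≠ 0) {i j k : Fin n} (hij : i ≠ j) (hjk : j ≠ k) (hik : i ≠ k) :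
    opT τ i j * opT τ j k * opT τ i j = opT τ j k * opT τ i j * opT τ j k := by
  refine LinearMap.ext fun f => funext fun w => ?_
  have h1 := cast_sub_ne_zero (val_apply_ne w hij)
  have h2 := cast_sub_ne_zero (val_apply_ne w hjk)
  have h3 := cast_sub_ne_zero (val_apply_ne w hik)
  have hs : swap j k * (swap i j * swap j k) = swap i j * (swap j k * swap i j) := by
    rw [← mul_assoc, ← mul_assoc, swap_mul_swap_mul_swap hij hik, swap_comm j k,
      swap_comm i j, swap_mul_swap_mul_swap hjk.symm hik.symm, swap_comm]
  simp only [Module.End.mul_apply, opT_apply, Perm.mul_apply, mul_assoc, hs, swap_mul_self, mul_one,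
    swap_apply_left, swap_apply_right, swap_apply_of_ne_of_ne hij hik,
    swap_apply_of_ne_of_ne hik.symm hjk.symm, coeffS, coeffOne]
  -- By `hs` both sides involve only the six values of f on the translates of w by the permutations
  -- of i, j, k. With these values as free variables, an identity of rational functions in u, v, z
  -- remains.
  generalize f w = a1
  generalize f (w * swap i j) = a2
  generalize f (w * swap j k) = a3
  generalize f (w * (swap i j * swap j k)) = a4
  generalize f (w * (swap j k * swap i j)) = a5
  generalize f (w * (swap i j * (swap j k * swap i j))) = a6
  generalize ((w i : ℕ) : ℂ) = u at *
  generalize ((w j : ℕ) : ℂ) = v at *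
  generalize ((w k : ℕ) : ℂ) = z at *
  rw [show v - u = -(u - v) by ring, show z - v = -(v - z) by ring]
  field_simp
  ring

theorem opX_mul_opXinv (i : Fin n) : opX i * opXinv i = 1 := by
  refine LinearMap.ext fun f => funext fun w => ?_
  exact mul_inv_cancel_left₀ (Nat.cast_add_one_ne_zero _) _

theorem opXinv_mul_opX (i : Fin n) : opXinv i * opX i = 1 := by
  refine LinearMap.ext fun f => funext fun w => ?_
  exact inv_mul_cancel_left₀ (Nat.cast_add_one_ne_zero _) _

theorem opX_comm (i j : Fin n) : opX i * opX j = opX j * opX i := by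
  refine LinearMap.ext fun f => funext fun w => ?_
  exact mul_left_comm _ _ _

theorem opPerm_mul (g h : Perm (Fin n)) : opPerm (g * h) = opPerm g * opPerm h := by
  refine LinearMap.ext fun f => funext fun w => ?_
  simp only [Module.End.mul_apply, opPerm_apply, mul_assoc]

theorem opPerm_one : opPerm (1 : Perm (Fin n)) = 1 := rfl

theorem opPerm_pow (g : Perm (Fin n)) (k : ℕ) : opPerm g ^ k = opPerm (g ^ k) := by
  induction k with
  | zero => rfl
  | succ k ih => rw [pow_succ, pow_succ, ih, opPerm_mul]

theorem opPerm_mul_opX (g : Perm (Fin n)) (i : Fin n) :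
    opPerm g * opX i = opX (g i) * opPerm g := rfl

theorem opPerm_mul_opT (τ : ℂ) (g : Perm (Fin n)) (i j : Fin n) :
    opPerm g * opT τ i j = opT τ (g i) (g j) * opPerm g := by
  refine LinearMap.ext fun f => funext fun w => ?_
  simp only [Module.End.mul_apply, opPerm_apply, opT_apply, Perm.mul_apply, mul_assoc,
    swap_apply_apply, inv_mul_cancel, mul_one]

theorem finRotate_eq {i j : Fin n} (h : j.val = i.val + 1) : finRotate n i = j := by
  obtain ⟨n, rfl⟩ : ∃ k, n = k + 1 := ⟨n - 1, by have := i.isLt; omega⟩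
  exact Fin.ext ((coe_finRotate_of_ne_last (by rintro rfl; have := j.isLt; simp at h; omega)).trans
    h.symm)

theorem finRotate_eq_zero {i j : Fin n} (hi : i.val + 1 = n) (hj : j.val = 0) :
    finRotate n i = j := by
  obtain ⟨n, rfl⟩ : ∃ k, n = k + 1 := ⟨n - 1, by omega⟩
  obtain rfl : i = Fin.last n := Fin.ext (by simpa using hi)
  obtain rfl : j = 0 := Fin.ext hj
  exact finRotate_last

theorem finRotate_pow_self : finRotate n ^ n = 1 := by
  obtain _ | _ | n := n
  · rfl
  · exact (pow_one _).trans finRotate_one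
  · have h := isCycle_finRotate (n := n) |>.orderOf
    rw [support_finRotate, Finset.card_univ, Fintype.card_fin] at h
    rw [← pow_orderOf_eq_one (finRotate (n + 2)), h]

/-- The index `i` of `T_i`, as an index of the `X`. -/
abbrev lower (i : Fin (n - 1)) : Fin n := ⟨i, by omega⟩

/-- The index `i + 1`, for the index `i` of `T_i`, as an index of the `X`. -/
abbrev upper (i : Fin (n - 1)) : Fin n := ⟨i + 1, by omega⟩

/-- The images of the generators of the double affine Hecke algebra. -/
noncomputable def gen (τ : ℂ) : DahaGen n → Module.End ℂ (Perm (Fin n) → ℂ)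
  | .T i => opT τ (lower i) (upper i)
  | .X i => opX i
  | .Xinv i => opXinv i
  | .pi => opPerm (finRotate n)
  | .piInv => opPerm (finRotate n)⁻¹

/-- The Demazure–Lusztig representation of the double affine Hecke algebra at `q = 1` on the
functions on the orbit of `(1, 2, …, n)`. -/
noncomputable def rep (n : ℕ) (τ : ℂˣ) :
    Daha n 1 τ →ₐ[ℂ] Module.End ℂ (Perm (Fin n) → ℂ) :=
  RingQuot.liftAlgHom ℂ ⟨FreeAlgebra.lift ℂ (gen (τ : ℂ)), by
    have hτ := τ.ne_zero
    intro a b h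
    induction h with
    | x_mul_inv i => simpa [gen] using opX_mul_opXinv i
    | inv_mul_x i => simpa [gen] using opXinv_mul_opX i
    | p_mul_inv => simp [gen, ← opPerm_mul, opPerm_one]
    | inv_mul_p => simp [gen, ← opPerm_mul, opPerm_one]
    | x_comm i j => simpa [gen] using opX_comm i j
    | txt i j k hj hk =>
      obtain rfl : j = lower i := Fin.ext hj
      obtain rfl : k = upper i := Fin.ext hk
      simpa [gen] using opT_mul_opX_mul_opT hτ (by simp)
    | tx_comm i j h₀ h₁ =>
      simpa [gen] using opT_mul_opX (fun h => h₀ (congrArg Fin.val h))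
        (fun h => h₁ (congrArg Fin.val h))
    | tt_comm i j h =>
      simpa [gen] using opT_comm (by simp) (by simp) (by simp; omega) (by simp; omega)
        (by simp; omega) (by simp; omega)
    | braid i j h =>
      have hl : upper i = lower j := Fin.ext h.symm
      simpa [gen, ← hl] using opT_braid hτ (i := lower i) (j := upper i) (k := upper j) (by simp)
        (by simp; omega) (by simp; omega)
    | px i j h => simpa [gen, finRotate_eq h] using opPerm_mul_opX (finRotate n) i
    -- At q = 1 the scalar in this relation is 1, so a plain cyclic rotation suffices.
    | px_last i j hi hj =>
      simpa [gen, finRotate_eq_zero hi hj] using opPerm_mul_opX (finRotate n) i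
    | pt i j h =>
      have h1 := opPerm_mul_opT (τ : ℂ) (finRotate n) (lower i) (upper i)
      rw [finRotate_eq (i := lower i) (j := lower j) h,
        finRotate_eq (i := upper i) (j := upper j) (by simpa using h)] at h1
      simpa [gen] using h1
    | pn_t j => simp [gen, opPerm_pow, finRotate_pow_self, opPerm_one]
    | quad i =>
      have h1 := opT_quad hτ (i := lower i) (j := upper i) (by simp)
      simp only [map_mul, map_sub, map_add, AlgHom.commutes, map_zero, FreeAlgebra.lift_ι_apply,
        gen]
      simp only [Algebra.algebraMap_eq_smul_one, sub_mul, mul_add, h1, smul_mul_assoc,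
        mul_smul_comm, one_mul, mul_one]
      match_scalars <;> field_simp <;> ring⟩

theorem rep_T {τ : ℂˣ} (i : Fin (n - 1)) :
    rep n τ (Daha.T i : (Daha n 1 τ)ˣ) = opT τ (lower i) (upper i) := by
  exact (RingQuot.liftAlgHom_mkAlgHom_apply ℂ _ _ _).trans (FreeAlgebra.lift_ι_apply _ _)

theorem rep_X {τ : ℂˣ} (i : Fin n) : rep n τ (Daha.X i : (Daha n 1 τ)ˣ) = opX i := by
  exact (RingQuot.liftAlgHom_mkAlgHom_apply ℂ _ _ _).trans (FreeAlgebra.lift_ι_apply _ _)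

end DemazureLusztig
/-! ### Calogero–Moser quadruples and operators -/

section CalogeroMoser

open Matrix

/-- A⁻¹ - c⁻¹ = -c⁻¹ (A - c) A⁻¹. -/
theorem rankSubScalar_inv {W : Type*} [AddCommGroup W] [Module ℂ W] (A : W ≃ₗ[ℂ] W) {c : ℂ}
    (hc : c ≠ 0) : rankSubScalar A⁻¹ c⁻¹ = rankSubScalar A c := by
  have h : (A⁻¹ : W ≃ₗ[ℂ] W).toLinearMap - c⁻¹ • LinearMap.id
      = (-c⁻¹ • (A.toLinearMap - c • LinearMap.id)) ∘ₗ (A⁻¹ : W ≃ₗ[ℂ] W).toLinearMap := by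
    ext w
    simp [smul_sub, smul_smul, hc]
    abel
  rw [rankSubScalar, rankSubScalar, h, LinearMap.range_comp_of_range_eq_top _
    (LinearEquiv.range _), LinearMap.range_smul _ _ (by simpa using hc)]

/-- Conjugate operators minus a scalar have the same rank. -/
theorem rankSubScalar_conj {W : Type*} [AddCommGroup W] [Module ℂ W] (A B : W ≃ₗ[ℂ] W) (c : ℂ) :
    rankSubScalar (B * A * B⁻¹) c = rankSubScalar A c := by
  have h : (B * A * B⁻¹ : W ≃ₗ[ℂ] W).toLinearMap - c • LinearMap.id
      = B.toLinearMap ∘ₗ (A.toLinearMap - c • LinearMap.id)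
        ∘ₗ (B⁻¹ : W ≃ₗ[ℂ] W).toLinearMap := by
    ext w
    simp
  rw [rankSubScalar, rankSubScalar, h, LinearMap.range_comp, LinearMap.range_comp_of_range_eq_top _
    (LinearEquiv.range _)]
  exact LinearEquiv.finrank_map_eq B _

theorem exists_eq_vecMulVec_of_finrank_range {n : ℕ} {W : Type*} [AddCommGroup W] [Module ℂ W]
    (b : Module.Basis (Fin n) ℂ W) (A : W →ₗ[ℂ] W)
    (h : Module.finrank ℂ (LinearMap.range A) = 1) :
    ∃ u v : Fin n → ℂ, LinearMap.toMatrix b b A = vecMulVec u v := by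
  obtain ⟨x, -, hx⟩ := finrank_eq_one_iff'.1 h
  choose c hc using fun i => hx ⟨A (b i), LinearMap.mem_range_self A _⟩
  refine ⟨b.repr x, c, ?_⟩
  ext i j
  have h1 : A (b j) = c j • (x : W) := (congrArg Subtype.val (hc j)).symm
  rw [LinearMap.toMatrix_apply, h1, vecMulVec_apply]
  simp [mul_comm]

theorem eq_smul_of_vecMulVec_eq {n : ℕ} {u v u' v' : Fin n → ℂ}
    (h : vecMulVec u v = vecMulVec u' v') (h0 : vecMulVec u v ≠ 0) :
    ∃ c : ℂˣ, u' = (c : ℂ) • u ∧ v' = ((c⁻¹ : ℂˣ) : ℂ) • v := by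
  have he : ∀ i j, u i * v j = u' i * v' j := fun i j => congrFun (congrFun h i) j
  obtain ⟨i, j, hij⟩ : ∃ i j, u i * v j ≠ 0 := by
    by_contra! hcon
    exact h0 (Matrix.ext hcon)
  have hu : u i ≠ 0 := left_ne_zero_of_mul hij
  have hv : v j ≠ 0 := right_ne_zero_of_mul hij
  have hij' := hij
  rw [he] at hij'
  have hu' : u' i ≠ 0 := left_ne_zero_of_mul hij'
  have hv' : v' j ≠ 0 := right_ne_zero_of_mul hij'
  -- The scaling factor is read off at an entry (i, j) where the product does not vanish.
  refine ⟨Units.mk0 (v j / v' j) (div_ne_zero hv hv'), ?_, ?_⟩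
  · ext k
    have := he k j
    simp only [Units.val_mk0, Pi.smul_apply, smul_eq_mul]
    field_simp
    linear_combination -this
  · ext k
    have h1 := he i k
    have h2 := he i j
    simp only [Units.val_inv_eq_inv_val, Units.val_mk0, Pi.smul_apply, smul_eq_mul]
    field_simp
    apply mul_left_cancel₀ hu'
    linear_combination (-v j) * h1 + v k * h2

/-- The matrix of an automorphism in a basis, as an element of the general linear group. -/
noncomputable def matrixGL {n : ℕ} {W : Type*} [AddCommGroup W] [Module ℂ W]
    (b : Module.Basis (Fin n) ℂ W) : (W ≃ₗ[ℂ] W) →* GL (Fin n) ℂ :=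
  (Units.map (LinearMap.toMatrixAlgEquiv b : (W →ₗ[ℂ] W) →* Matrix (Fin n) (Fin n) ℂ)).comp
    (LinearMap.GeneralLinearGroup.generalLinearEquiv ℂ W).symm.toMonoidHom

theorem coe_matrixGL {n : ℕ} {W : Type*} [AddCommGroup W] [Module ℂ W]
    (b : Module.Basis (Fin n) ℂ W) (A : W ≃ₗ[ℂ] W) :
    (matrixGL b A : Matrix (Fin n) (Fin n) ℂ) = LinearMap.toMatrix b b A.toLinearMap := rfl

theorem toMatrix_sub_smul_id {n : ℕ} {W : Type*} [AddCommGroup W] [Module ℂ W]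
    (b : Module.Basis (Fin n) ℂ W) (A : W ≃ₗ[ℂ] W) (c : ℂ) :
    LinearMap.toMatrix b b (A.toLinearMap - c • LinearMap.id)
      = (matrixGL b A : Matrix (Fin n) (Fin n) ℂ) - c • 1 := by
  rw [map_sub, map_smul, LinearMap.toMatrix_id, coe_matrixGL]

/-! ### Orbits of quadruples with prescribed operators -/

namespace CMQuad

variable {n : ℕ} {t : ℂˣ} {W : Type*} [AddCommGroup W] [Module ℂ W]

theorem represents_iff {a : CMQuad n t} {b : Module.Basis (Fin n) ℂ W} {A B : W ≃ₗ[ℂ] W} :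
    a.Represents b A B ↔ a.X = matrixGL b A ∧ a.Y = matrixGL b B := by
  rw [Represents, ← coe_matrixGL, ← coe_matrixGL, Units.val_inj, Units.val_inj]

theorem exists_represents (b : Module.Basis (Fin n) ℂ W) (A B : W ≃ₗ[ℂ] W)
    (h : rankSubScalar (A * B * A⁻¹ * B⁻¹) ((t : ℂ)⁻¹ ^ 2) = 1) :
    ∃ a : CMQuad n t, a.Represents b A B := by
  -- The equation of `CMQuad` involves A⁻¹B⁻¹AB, which is conjugate by BA to the commutator of the
  -- rank condition.
  rw [show A * B * A⁻¹ * B⁻¹ = (B * A) * (A⁻¹ * B⁻¹ * A * B) * (B * A)⁻¹ by group,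
    rankSubScalar_conj] at h
  obtain ⟨u, v, huv⟩ := exists_eq_vecMulVec_of_finrank_range b _ h
  rw [toMatrix_sub_smul_id] at huv
  -- The factorization is that of the commutator minus t⁻²; the defining equation is t times it,
  -- whence the factor t on u.
  refine ⟨⟨matrixGL b A, matrixGL b B, (t : ℂ) • u, v, ?_⟩, represents_iff.2 ⟨rfl, rfl⟩⟩
  rw [smul_vecMulVec, ← huv, smul_sub, smul_smul, map_mul, map_mul, map_mul, map_inv, map_inv]
  congr 2
  have := t.ne_zero
  field_simp

theorem vecMulVec_ne_zero {a : CMQuad n t} {b : Module.Basis (Fin n) ℂ W} {A B : W ≃ₗ[ℂ] W}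
    (h : rankSubScalar (A * B * A⁻¹ * B⁻¹) ((t : ℂ)⁻¹ ^ 2) = 1) (ha : a.Represents b A B) :
    vecMulVec a.U a.V ≠ 0 := by
  rw [show A * B * A⁻¹ * B⁻¹ = (B * A) * (A⁻¹ * B⁻¹ * A * B) * (B * A)⁻¹ by group,
    rankSubScalar_conj] at h
  obtain ⟨hX, hY⟩ := represents_iff.1 ha
  intro h0
  have h1 := a.eqn
  rw [h0, hX, hY, ← map_inv, ← map_inv, ← map_mul, ← map_mul, ← map_mul] at h1
  have h2 : LinearMap.toMatrix b b
      ((A⁻¹ * B⁻¹ * A * B : W ≃ₗ[ℂ] W).toLinearMap - (t : ℂ)⁻¹ ^ 2 • LinearMap.id) = 0 := by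
    rw [toMatrix_sub_smul_id]
    apply (smul_right_injective _ t.ne_zero : Function.Injective fun x => (t : ℂ) • x)
    simp only
    rw [smul_zero, ← h1, smul_sub, smul_smul]
    congr 2
    have := t.ne_zero
    field_simp
  rw [rankSubScalar, (LinearEquiv.map_eq_zero_iff _).1 h2, LinearMap.range_zero,
    finrank_bot] at h
  exact zero_ne_one h

theorem matrixGL_basis_change (b b' : Module.Basis (Fin n) ℂ W) :
    ∃ g : GL (Fin n) ℂ, ∀ A : W ≃ₗ[ℂ] W, matrixGL b' A = g * matrixGL b A * g⁻¹ := by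
  refine ⟨⟨b'.toMatrix b, b.toMatrix b', b'.toMatrix_mul_toMatrix_flip b,
    b.toMatrix_mul_toMatrix_flip b'⟩, fun A => Units.ext ?_⟩
  exact (basis_toMatrix_mul_linearMap_toMatrix_mul_basis_toMatrix b' b b' b A.toLinearMap).symm

theorem smul_X (g : GL (Fin n) ℂ) (a : CMQuad n t) : (g • a).X = g * a.X * g⁻¹ := rfl

theorem smul_Y (g : GL (Fin n) ℂ) (a : CMQuad n t) : (g • a).Y = g * a.Y * g⁻¹ := rfl

theorem smul_U (g : GL (Fin n) ℂ) (a : CMQuad n t) :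
    (g • a).U = (g : Matrix (Fin n) (Fin n) ℂ) *ᵥ a.U := rfl

theorem smul_V (g : GL (Fin n) ℂ) (a : CMQuad n t) :
    (g • a).V = a.V ᵥ* ((g⁻¹ : GL (Fin n) ℂ) : Matrix (Fin n) (Fin n) ℂ) := rfl

theorem cls_smul (g : GL (Fin n) ℂ) (a : CMQuad n t) : (g • a).cls = a.cls :=
  Quotient.sound (s := MulAction.orbitRel (GL (Fin n) ℂ) (CMQuad n t)) ⟨g, rfl⟩

/-- The two pairs (U, V) differ by (c, c⁻¹), and the scalar matrix c acts in this way while fixing X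
and Y. -/
theorem cls_eq_of_vecMulVec_ne_zero {a a' : CMQuad n t} (hX : a.X = a'.X) (hY : a.Y = a'.Y)
    (h0 : vecMulVec a.U a.V ≠ 0) : a.cls = a'.cls := by
  obtain ⟨c, hU, hV⟩ := eq_smul_of_vecMulVec_eq
    (by rw [← a.eqn, ← a'.eqn, hX, hY] : vecMulVec a.U a.V = vecMulVec a'.U a'.V) h0
  let g : GL (Fin n) ℂ := Units.map (algebraMap ℂ (Matrix (Fin n) (Fin n) ℂ)).toMonoidHom c
  have hg : ∀ x : GL (Fin n) ℂ, g * x * g⁻¹ = x := fun x => by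
    rw [mul_inv_eq_iff_eq_mul]
    exact Units.ext (Algebra.commutes (c : ℂ) (x : Matrix (Fin n) (Fin n) ℂ))
  have hgv : (g : Matrix (Fin n) (Fin n) ℂ) = (c : ℂ) • 1 := Algebra.algebraMap_eq_smul_one _
  have hgi : ((g⁻¹ : GL (Fin n) ℂ) : Matrix (Fin n) (Fin n) ℂ) = ((c⁻¹ : ℂˣ) : ℂ) • 1 :=
    Algebra.algebraMap_eq_smul_one _
  rw [← cls_smul g a]
  congr 1
  ext1
  · rw [smul_X, hg, hX]
  · rw [smul_Y, hg, hY]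
  · rw [smul_U, hgv, hU, smul_mulVec, one_mulVec]
  · rw [smul_V, hgi, hV, vecMul_smul, vecMul_one]

theorem cls_eq_of_represents {b b' : Module.Basis (Fin n) ℂ W} {A B : W ≃ₗ[ℂ] W}
    (h : rankSubScalar (A * B * A⁻¹ * B⁻¹) ((t : ℂ)⁻¹ ^ 2) = 1) {a a' : CMQuad n t}
    (ha : a.Represents b A B) (ha' : a'.Represents b' A B) : a.cls = a'.cls := by
  obtain ⟨g, hg⟩ := matrixGL_basis_change b b'
  have hr : (g • a).Represents b' A B := by
    obtain ⟨hX, hY⟩ := represents_iff.1 ha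
    exact represents_iff.2 ⟨by rw [hg, smul_X, hX], by rw [hg, smul_Y, hY]⟩
  rw [← cls_smul g a]
  obtain ⟨hX, hY⟩ := represents_iff.1 hr
  obtain ⟨hX', hY'⟩ := represents_iff.1 ha'
  exact cls_eq_of_vecMulVec_ne_zero (hX.trans hX'.symm) (hY.trans hY'.symm)
    (vecMulVec_ne_zero h hr)

theorem Represents.map {W' : Type*} [AddCommGroup W'] [Module ℂ W'] {a : CMQuad n t}
    {b : Module.Basis (Fin n) ℂ W} {A B : W ≃ₗ[ℂ] W} {A' B' : W' ≃ₗ[ℂ] W'} (e : W ≃ₗ[ℂ] W')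
    (hA : ∀ w, e (A w) = A' (e w)) (hB : ∀ w, e (B w) = B' (e w)) (ha : a.Represents b A B) :
    a.Represents (b.map e) A' B' := by
  refine ⟨ha.1.trans ?_, ha.2.trans ?_⟩ <;>
    · ext i j
      simp [LinearMap.toMatrix_apply, ← hA, ← hB]

end CMQuad

end CalogeroMoser
/-! ### The finite Hecke algebra inside the double affine Hecke algebra -/

namespace Daha

variable {n : ℕ} {q τ : ℂˣ}

/-- `T_{i+1}`, extended by `1` to all natural numbers `i`. -/
noncomputable def natT (n : ℕ) (q τ : ℂˣ) (i : ℕ) : (Daha n q τ)ˣ :=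
  if h : i < n - 1 then T ⟨i, h⟩ else 1

theorem natT_val (i : Fin (n - 1)) : natT n q τ i = T i := dif_pos i.isLt

theorem isHeckeFamily_natT : IsHeckeFamily (τ : ℂ) (n - 1) fun i => (natT n q τ i : Daha n q τ) where
  quad i hi := by
    rw [natT, dif_pos hi]
    exact quad_eq ⟨i, hi⟩
  braid i hi := by
    rw [natT, natT, dif_pos hi, dif_pos (by omega : i < n - 1)]
    have h := mk_rel (q := q) (τ := τ) (.braid ⟨i, by omega⟩ ⟨i + 1, hi⟩ rfl)
    simp only [map_mul] at h
    exact h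
  comm i j hij hj := by
    rw [natT, natT, dif_pos hj, dif_pos (by omega : i < n - 1)]
    have h := mk_rel (q := q) (τ := τ) (.tt_comm ⟨i, by omega⟩ ⟨j, hj⟩ (Or.inl hij))
    simp only [map_mul] at h
    exact h

theorem finiteHecke_eq : finiteHecke n q τ
    = Algebra.adjoin ℂ ((fun i => (natT n q τ i : Daha n q τ)) '' Set.Iio (n - 1)) := by
  rw [finiteHecke]
  congr 1
  ext x
  constructor
  · rintro ⟨i, rfl⟩
    exact ⟨i, i.isLt, by simp only [natT_val]⟩
  · rintro ⟨i, hi, rfl⟩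
    exact ⟨⟨i, hi⟩, by simp only [← natT_val]⟩

theorem prodT_eq : (prodT : (Daha n q τ)ˣ) = ascProd (natT n q τ) (n - 1) := by
  rw [prodT, ← prod_ofFn_eq_ascProd]
  simp only [natT_val]

theorem Z_eq : (Z : (Daha n q τ)ˣ)
    = ascProd (natT n q τ) (n - 1) * descProd (natT n q τ) (n - 1) := by
  rw [Z, ← prod_ofFn_eq_ascProd, ← prod_reverse_ofFn_eq_descProd]
  simp only [natT_val]

theorem coe_Z : ((Z : (Daha n q τ)ˣ) : Daha n q τ)
    = ascProd (fun i => (natT n q τ i : Daha n q τ)) (n - 1)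
      * descProd (fun i => (natT n q τ i : Daha n q τ)) (n - 1) := by
  rw [Z_eq, Units.val_mul]
  exact congrArg₂ _ (map_ascProd (Units.coeHom (Daha n q τ)) _ _)
    (map_descProd (Units.coeHom (Daha n q τ)) _ _)

theorem X_succ {k : ℕ} (hk : k + 1 < n) :
    (X ⟨k + 1, hk⟩ : (Daha n q τ)ˣ)
      = natT n q τ k * X ⟨k, by omega⟩ * natT n q τ k := by
  rw [natT, dif_pos (by omega : k < n - 1)]
  have h := mk_rel (q := q) (τ := τ)
    (.txt ⟨k, by omega⟩ ⟨k, by omega⟩ ⟨k + 1, hk⟩ rfl rfl)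
  simp only [map_mul] at h
  exact Units.ext h.symm

theorem X_eq_descProd_mul [NeZero n] {k : ℕ} (hk : k < n) :
    (X ⟨k, hk⟩ : (Daha n q τ)ˣ)
      = descProd (natT n q τ) k * X₁ * ascProd (natT n q τ) k := by
  induction k with
  | zero => simp [descProd, ascProd]; rfl
  | succ k ih =>
    rw [X_succ, ih (by omega), descProd, ascProd]
    simp only [mul_assoc]

theorem pi_mul_X_last [NeZero n] : (pi * X ⟨n - 1, Nat.sub_one_lt NeZero.out⟩ : (Daha n 1 τ)ˣ)
    = X₁ * pi := by
  have h := mk_rel (q := 1) (τ := τ) (.px_last (⟨n - 1, Nat.sub_one_lt NeZero.out⟩ : Fin n) 0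
    (Nat.sub_add_cancel NeZero.one_le) rfl)
  simp only [map_mul, Units.val_one, inv_one, one_smul] at h
  exact Units.ext h

/-- Conjugation by π⁻¹ turns X₁ into X_n = `descProd * X₁ * ascProd`; the last factor cancels
`prodT⁻¹` and then X₁ cancels. -/
theorem Y₁_commutator_X₁ [NeZero n] :
    (Y₁ * X₁ * Y₁⁻¹ * X₁⁻¹ : (Daha n 1 τ)ˣ) = Z := by
  have h1 : (pi⁻¹ * X₁ * pi : (Daha n 1 τ)ˣ) = X ⟨n - 1, Nat.sub_one_lt NeZero.out⟩ := by
    rw [mul_assoc, ← pi_mul_X_last, inv_mul_cancel_left]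
  calc (Y₁ * X₁ * Y₁⁻¹ * X₁⁻¹ : (Daha n 1 τ)ˣ)
      = prodT * (pi⁻¹ * X₁ * pi) * prodT⁻¹ * X₁⁻¹ := by rw [Y₁]; group
    _ = Z := by
      rw [h1, X_eq_descProd_mul, prodT_eq, Z_eq]
      group

theorem X₁_commutator_Y₁ [NeZero n] :
    (X₁ * Y₁ * X₁⁻¹ * Y₁⁻¹ : (Daha n 1 τ)ˣ) = Z⁻¹ := by
  rw [← Y₁_commutator_X₁]
  group

/-- No braid computation is needed: Z is a product of elements that commute with these T_i. -/
theorem Z_comm [NeZero n] (i : Fin (n - 1)) (hi : 0 < i.val) :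
    Commute (Z : (Daha n 1 τ)ˣ) (T i) := by
  rw [← Y₁_commutator_X₁]
  exact (((Y₁_comm i hi).mul_left (X₁_comm i hi)).mul_left (Y₁_comm i hi).inv_left).mul_left
    (X₁_comm i hi).inv_left

/-- The symmetrizer of `A^{n-1}_τ`. -/
noncomputable def tailSymm (n : ℕ) (q τ : ℂˣ) : Daha n q τ :=
  heckeSymm (τ : ℂ) (n - 1 - 1) fun i => (natT n q τ (i + 1) : Daha n q τ)

theorem natT_succ {i : ℕ} (hi : i + 1 < n - 1) : natT n q τ (i + 1) = T ⟨i + 1, hi⟩ :=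
  dif_pos hi

theorem commute_tailSymm {g : (Daha n q τ)ˣ} (hg : ∀ i : Fin (n - 1), 0 < i.val → Commute g (T i)) :
    Commute (g : Daha n q τ) (tailSymm n q τ) := by
  refine commute_heckeSymm fun i hi => ?_
  rw [natT_succ (by omega)]
  exact (hg _ (Nat.succ_pos i)).map (Units.coeHom (Daha n q τ))

theorem tailSymm_mul_natT {i : ℕ} (hi : i + 1 < n - 1) :
    tailSymm n q τ * natT n q τ (i + 1) = (τ : ℂ) • tailSymm n q τ :=
  isHeckeFamily_natT.shift.heckeSymm_mul τ.ne_zero (by omega)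

theorem natT_mul_tailSymm (hτ : ∀ k : ℕ, 0 < k → (τ : ℂ) ^ k ≠ 1) {i : ℕ} (hi : i + 1 < n - 1) :
    natT n q τ (i + 1) * tailSymm n q τ = (τ : ℂ) • tailSymm n q τ :=
  isHeckeFamily_natT.shift.mul_heckeSymm hτ τ.ne_zero (by omega)

theorem natT_mem {i : ℕ} (hi : i < n - 1) : (natT n q τ i : Daha n q τ) ∈ finiteHecke n q τ := by
  rw [finiteHecke_eq]
  exact Algebra.subset_adjoin ⟨i, hi, rfl⟩

theorem tailSymm_mem : tailSymm n q τ ∈ finiteHecke n q τ :=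
  heckeSymm_mem fun i hi => natT_mem (by omega)

theorem mul_ascProd_mem {j : ℕ} (hj : j ≤ n - 1) :
    tailSymm n q τ * ascProd (fun i => (natT n q τ i : Daha n q τ)) j ∈ finiteHecke n q τ :=
  (finiteHecke n q τ).mul_mem tailSymm_mem (ascProd_mem (fun _ hi => natT_mem hi) hj)

/-! ### Non-vanishing, tested in the Demazure–Lusztig representation -/

open DemazureLusztig in
theorem rep_natT_smul_one {i : ℕ} (hi : i < n - 1) :
    rep n τ (natT n 1 τ i) • (1 : Equiv.Perm (Fin n) → ℂ) = (τ : ℂ) • 1 := by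
  rw [natT, dif_pos hi, rep_T]
  exact opT_one τ.ne_zero (by simp)

open DemazureLusztig in
theorem rep_tailSymm_smul_one : rep n τ (tailSymm n 1 τ) • (1 : Equiv.Perm (Fin n) → ℂ)
    = heckePoincare (τ : ℂ) (n - 1 - 1) • 1 := by
  rw [tailSymm, map_heckeSymm]
  exact heckeSymm_smul fun i hi => rep_natT_smul_one (by omega)

open DemazureLusztig in
theorem tailSymm_mul_cosetSum_ne_zero (hτ : ∀ k : ℕ, 0 < k → (τ : ℂ) ^ k ≠ 1) :
    tailSymm n 1 τ * cosetSum (τ : ℂ) (fun i => (natT n 1 τ i : Daha n 1 τ)) (n - 1) ≠ 0 := by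
  intro h
  have h1 := congrArg (fun a => rep n τ a • (1 : Equiv.Perm (Fin n) → ℂ)) h
  simp only [map_mul, map_cosetSum, mul_smul, map_zero, zero_smul] at h1
  rw [cosetSum_smul fun i hi => rep_natT_smul_one hi, smul_comm, rep_tailSymm_smul_one,
    smul_smul] at h1
  exact mul_ne_zero (sum_even_pow_ne_zero hτ _) (heckePoincare_ne_zero hτ _)
    (by simpa using congrFun h1 1)

/-- In X_{k+1} = T_k X_k T_k the left factor is absorbed by e directly, the right one after e has
been moved past X₁; each gives a factor τ. -/
theorem mul_X_eq_of_invariant [NeZero n] {e : Daha n q τ} (hX : Commute (X₁ : (Daha n q τ)ˣ).val e)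
    (he : ∀ i < n - 1, e * natT n q τ i = (τ : ℂ) • e) {k : ℕ} (hk : k < n) :
    e * (X ⟨k, hk⟩ : (Daha n q τ)ˣ) = (τ : ℂ) ^ (2 * k) • ((X₁ : (Daha n q τ)ˣ) * e) := by
  induction k with
  | zero =>
    rw [hX.eq, mul_zero, pow_zero, one_smul]
    rfl
  | succ k ih =>
    rw [X_succ, Units.val_mul, Units.val_mul, ← mul_assoc, ← mul_assoc, he k (by omega),
      smul_mul_assoc, smul_mul_assoc, ih (by omega), smul_mul_assoc, mul_assoc, he k (by omega),
      mul_smul_comm, smul_smul, smul_smul]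
    congr 1
    ring

open DemazureLusztig in
-- Otherwise e would be right invariant under all T_i, and e ∑ X_k would be a nonzero multiple of X₁
-- e. On the constant function ∑ X_k acts by a scalar, whereas X₁ gives the non-constant function w
-- ↦ w(0) + 1.
theorem tailSymm_mul_natT_zero_ne (hτ : ∀ k : ℕ, 0 < k → (τ : ℂ) ^ k ≠ 1) (hn : 0 < n - 1) :
    tailSymm n 1 τ * natT n 1 τ 0 ≠ (τ : ℂ) • tailSymm n 1 τ := by
  intro h
  have : NeZero n := ⟨by omega⟩
  have he : ∀ i < n - 1, tailSymm n 1 τ * natT n 1 τ i = (τ : ℂ) • tailSymm n 1 τ := by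
    rintro (_ | i) hi
    · exact h
    · exact tailSymm_mul_natT hi
  have hX := fun k : Fin n => mul_X_eq_of_invariant (commute_tailSymm X₁_comm) he k.isLt
  have hsum : tailSymm n 1 τ * ∑ k : Fin n, ((X k : (Daha n 1 τ)ˣ) : Daha n 1 τ)
      = (∑ k ∈ Finset.range (n - 1 + 1), (τ : ℂ) ^ (2 * k)) •
        ((X₁ : (Daha n 1 τ)ˣ) * tailSymm n 1 τ) := by
    rw [Finset.mul_sum, Nat.sub_add_cancel (by omega), Finset.sum_range, Finset.sum_smul]
    exact Finset.sum_congr rfl fun k _ => hX k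
  have hc : rep n τ (∑ k : Fin n, ((X k : (Daha n 1 τ)ˣ) : Daha n 1 τ)) • (1 : Equiv.Perm (Fin n) → ℂ)
      = (∑ k : Fin n, ((k : ℕ) + 1 : ℂ)) • 1 := by
    ext w
    rw [map_sum, Finset.sum_smul, Finset.sum_apply]
    simp only [rep_X, Module.End.smul_def, opX_apply, Pi.one_apply, mul_one, Pi.smul_apply,
      smul_eq_mul]
    exact Equiv.sum_comp w fun k : Fin n => ((k : ℕ) + 1 : ℂ)
  have h1 := congrArg (fun a => rep n τ a • (1 : Equiv.Perm (Fin n) → ℂ)) hsum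
  simp only [map_mul, map_smul, mul_smul, smul_assoc] at h1
  rw [hc, smul_comm, rep_tailSymm_smul_one, smul_comm (rep n τ _), smul_smul, smul_smul] at h1
  have h2 : ∀ w : Equiv.Perm (Fin n), ((∑ k : Fin n, ((k : ℕ) + 1 : ℂ)) *
      heckePoincare (τ : ℂ) (n - 1 - 1)) = ((∑ k ∈ Finset.range (n - 1 + 1), (τ : ℂ) ^ (2 * k)) *
      heckePoincare (τ : ℂ) (n - 1 - 1)) * ((w 0 : ℕ) + 1 : ℂ) := by
    intro w
    have h3 := congrFun h1 w
    rw [X₁, rep_X] at h3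
    simpa [opX_apply] using h3
  -- The identity and the transposition of 0 and 1 give X₁ the distinct values 1 and 2.
  have h4 := (h2 1).symm.trans (h2 (Equiv.swap 0 ⟨1, by omega⟩))
  have h5 := mul_left_cancel₀
    (mul_ne_zero (sum_even_pow_ne_zero hτ (n - 1)) (heckePoincare_ne_zero hτ (n - 1 - 1))) h4
  simp at h5

theorem linearIndependent_tailSymm_mul_ascProd (hτ : ∀ k : ℕ, 0 < k → (τ : ℂ) ^ k ≠ 1) :
    LinearIndependent ℂ fun j : Fin (n - 1 + 1) =>
      tailSymm n 1 τ * ascProd (fun i => (natT n 1 τ i : Daha n 1 τ)) j :=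
  isHeckeFamily_natT.linearIndependent_mul_ascProd τ.ne_zero (fun _ hi => tailSymm_mul_natT hi)
    (tailSymm_mul_natT_zero_ne hτ) (tailSymm_mul_cosetSum_ne_zero hτ)

theorem tailSymm_mul_Z_sub :
    tailSymm n q τ * (Z : (Daha n q τ)ˣ) - (τ : ℂ)⁻¹ ^ 2 • tailSymm n q τ
      = ((τ : ℂ)⁻¹ * (τ - (τ : ℂ)⁻¹)) •
        (tailSymm n q τ * cosetSum (τ : ℂ) (fun i => (natT n q τ i : Daha n q τ)) (n - 1)) := by
  rw [coe_Z]
  exact isHeckeFamily_natT.mul_ascProd_mul_descProd_sub τ.ne_zero fun _ hi => tailSymm_mul_natT hi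

theorem coe_Z_mem : ((Z : (Daha n q τ)ˣ) : Daha n q τ) ∈ finiteHecke n q τ := by
  rw [coe_Z]
  exact (finiteHecke n q τ).mul_mem (ascProd_mem (fun _ hi => natT_mem hi) le_rfl)
    (descProd_mem (fun _ hi => natT_mem hi) le_rfl)

theorem restrict_mul {V : Type*} [AddCommGroup V] [Module ℂ V]
    [Module (Daha n q τ) V] [IsScalarTower ℂ (Daha n q τ) V] {g h : (Daha n q τ)ˣ}
    (hg : ∀ i : Fin (n - 1), 0 < i.val → Commute g (T i))
    (hh : ∀ i : Fin (n - 1), 0 < i.val → Commute h (T i)) :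
    restrict V g hg * restrict V h hh
      = restrict V (g * h) fun i hi => (hg i hi).mul_left (hh i hi) :=
  LinearEquiv.ext fun v => Subtype.ext (smul_smul _ _ (v : V))

theorem restrict_inv {V : Type*} [AddCommGroup V] [Module ℂ V]
    [Module (Daha n q τ) V] [IsScalarTower ℂ (Daha n q τ) V] {g : (Daha n q τ)ˣ}
    (hg : ∀ i : Fin (n - 1), 0 < i.val → Commute g (T i)) :
    (restrict V g hg)⁻¹ = restrict V g⁻¹ fun i hi => (hg i hi).inv_left :=
  rfl

end Daha
/-! ### The invariants of a regular irreducible representation -/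

namespace RegularIrrep

open Daha

variable {n : ℕ} {τ : ℂˣ} (M : RegularIrrep.{u} n τ)

/-- The target is all of H, so that the identities for Hecke families can be used without passing to
the subalgebra. -/
theorem exists_embedding : ∃ ψ : M.V →ₗ[ℂ] Daha n 1 τ, Function.Injective ψ ∧
    (∀ a, a ∈ finiteHecke n 1 τ ↔ ∃ v, ψ v = a) ∧
    ∀ a ∈ finiteHecke n 1 τ, ∀ v, ψ (a • v) = a * ψ v := by
  obtain ⟨φ⟩ := M.regular
  refine ⟨(finiteHecke n 1 τ).val.toLinearMap ∘ₗ (φ.restrictScalars ℂ).toLinearMap,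
    Subtype.val_injective.comp φ.injective, fun a => ⟨fun ha => ⟨φ.symm ⟨a, ha⟩, ?_⟩, ?_⟩,
    fun a ha v => ?_⟩
  · exact congrArg Subtype.val (φ.apply_symm_apply ⟨a, ha⟩)
  · rintro ⟨v, rfl⟩
    exact (φ v).2
  · exact congrArg Subtype.val (φ.map_smul ⟨a, ha⟩ v)

variable {M} {ψ : M.V →ₗ[ℂ] Daha n 1 τ}

theorem mem_inv_iff (hψ : Function.Injective ψ)
    (hmul : ∀ a ∈ finiteHecke n 1 τ, ∀ v, ψ (a • v) = a * ψ v) {v : M.V} :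
    v ∈ M.inv ↔ ∀ i, i + 1 < n - 1 → natT n 1 τ (i + 1) * ψ v = (τ : ℂ) • ψ v := by
  constructor
  · intro hv i hi
    rw [← hmul _ (natT_mem hi), natT_succ hi, hv _ (Nat.succ_pos i), map_smul]
  · intro hv i hi
    obtain ⟨k, hk⟩ : ∃ k, i.val = k + 1 := ⟨i.val - 1, by omega⟩
    have h := hv k (by omega)
    rw [← hk, natT_val] at h
    apply hψ
    rw [hmul _ (by rw [← natT_val]; exact natT_mem i.isLt), h, map_smul]

theorem embedding_eq (hτ : ∀ k : ℕ, 0 < k → (τ : ℂ) ^ k ≠ 1) (hψ : Function.Injective ψ)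
    (hmul : ∀ a ∈ finiteHecke n 1 τ, ∀ v, ψ (a • v) = a * ψ v) {v : M.V} (hv : v ∈ M.inv) :
    ψ v = (heckePoincare (τ : ℂ) (n - 1 - 1))⁻¹ • (tailSymm n 1 τ * ψ v) := by
  have h : tailSymm n 1 τ • ψ v = heckePoincare (τ : ℂ) (n - 1 - 1) • ψ v :=
    heckeSymm_smul fun i hi => (mem_inv_iff hψ hmul).1 hv i (by omega)
  rw [← smul_eq_mul, h, smul_smul, inv_mul_cancel₀ (heckePoincare_ne_zero hτ _), one_smul]

/-- The image is eA: an invariant equals e times itself up to the nonzero Poincaré value, and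
conversely left invariance of e makes every element of eA invariant. -/
theorem map_inv_eq_span (hτ : ∀ k : ℕ, 0 < k → (τ : ℂ) ^ k ≠ 1) (hψ : Function.Injective ψ)
    (hrange : ∀ a, a ∈ finiteHecke n 1 τ ↔ ∃ v, ψ v = a)
    (hmul : ∀ a ∈ finiteHecke n 1 τ, ∀ v, ψ (a • v) = a * ψ v) :
    M.inv.map ψ = Submodule.span ℂ (Set.range fun j : Fin (n - 1 + 1) =>
      tailSymm n 1 τ * ascProd (fun i => (natT n 1 τ i : Daha n 1 τ)) j) := by
  apply le_antisymm
  · rintro _ ⟨v, hv, rfl⟩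
    rw [embedding_eq hτ hψ hmul hv]
    refine Submodule.smul_mem _ _ (isHeckeFamily_natT.mul_mem_span
      (fun _ hi => tailSymm_mul_natT hi) ?_)
    rw [← finiteHecke_eq]
    exact (hrange _).2 ⟨v, rfl⟩
  · rw [Submodule.span_le]
    rintro _ ⟨j, rfl⟩
    obtain ⟨v, hv⟩ := (hrange _).1 (mul_ascProd_mem (q := 1) (τ := τ) (Nat.lt_succ_iff.1 j.isLt))
    refine ⟨v, (mem_inv_iff hψ hmul).2 fun i hi => ?_, hv⟩
    rw [hv, ← mul_assoc, natT_mul_tailSymm hτ hi, smul_mul_assoc]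

theorem finrank_inv [NeZero n] (hτ : ∀ k : ℕ, 0 < k → (τ : ℂ) ^ k ≠ 1) (M : RegularIrrep.{u} n τ) :
    Module.finrank ℂ M.inv = n := by
  obtain ⟨ψ, hψ, hrange, hmul⟩ := M.exists_embedding
  rw [(Submodule.equivMapOfInjective ψ hψ M.inv).finrank_eq, map_inv_eq_span hτ hψ hrange hmul,
    finrank_span_eq_card (linearIndependent_tailSymm_mul_ascProd hτ), Fintype.card_fin,
    Nat.sub_add_cancel NeZero.one_le]

theorem Ybar_commutator_Xbar [NeZero n] (M : RegularIrrep.{u} n τ) :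
    M.Ybar * M.Xbar * M.Ybar⁻¹ * M.Xbar⁻¹ = restrict M.V Z (Z_comm (n := n) (τ := τ)) := by
  simp only [Xbar, Ybar, Daha.Xbar, Daha.Ybar, restrict_inv, restrict_mul, Y₁_commutator_X₁]

theorem rankSubScalar_commutator [NeZero n] (hτ : ∀ k : ℕ, 0 < k → (τ : ℂ) ^ k ≠ 1)
    (M : RegularIrrep.{u} n τ) :
    rankSubScalar (M.Ybar * M.Xbar * M.Ybar⁻¹ * M.Xbar⁻¹) ((τ : ℂ)⁻¹ ^ 2) = 1 := by
  obtain ⟨ψ, hψ, hrange, hmul⟩ := M.exists_embedding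
  rw [Ybar_commutator_Xbar]
  set D := (restrict M.V Z (Z_comm (n := n) (τ := τ))).toLinearMap - (τ : ℂ)⁻¹ ^ 2 • LinearMap.id
  set s := tailSymm n 1 τ * cosetSum (τ : ℂ) (fun i => (natT n 1 τ i : Daha n 1 τ)) (n - 1)
  have hs0 : s ≠ 0 := tailSymm_mul_cosetSum_ne_zero hτ
  -- This constant is nonzero because τ² ≠ 1.
  have hκ : (τ : ℂ)⁻¹ * (τ - (τ : ℂ)⁻¹) ≠ 0 := by
    refine mul_ne_zero (inv_ne_zero τ.ne_zero) fun h => hτ 2 two_pos ?_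
    rw [sq]
    nth_rw 2 [sub_eq_zero.1 h]
    exact mul_inv_cancel₀ τ.ne_zero
  have hψD : ∀ v : M.inv, ψ (D v) = (Z : (Daha n 1 τ)ˣ) * ψ v - (τ : ℂ)⁻¹ ^ 2 • ψ v := by
    intro v
    have h1 : ((D v : M.inv) : M.V) = ((Z : (Daha n 1 τ)ˣ) : Daha n 1 τ) • (v : M.V)
      - (τ : ℂ)⁻¹ ^ 2 • (v : M.V) := rfl
    rw [h1, map_sub, hmul _ coe_Z_mem, map_smul]
  have hZ : (Z : (Daha n 1 τ)ˣ) * tailSymm n 1 τ - (τ : ℂ)⁻¹ ^ 2 • tailSymm n 1 τ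
      = ((τ : ℂ)⁻¹ * (τ - (τ : ℂ)⁻¹)) • s := by
    rw [(commute_tailSymm (Z_comm (n := n) (τ := τ))).eq, tailSymm_mul_Z_sub]
  have hj : Function.Injective (ψ ∘ₗ M.inv.subtype) := hψ.comp Subtype.val_injective
  have hrng : (LinearMap.range D).map (ψ ∘ₗ M.inv.subtype) = Submodule.span ℂ {s} := by
    apply le_antisymm
    · rintro _ ⟨_, ⟨v, rfl⟩, rfl⟩
      have hv : ψ v ∈ finiteHecke n 1 τ := (hrange _).2 ⟨v, rfl⟩
      rw [finiteHecke_eq] at hv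
      obtain ⟨c, hc⟩ := isHeckeFamily_natT.mul_cosetSum_mul_mem_span τ.ne_zero
        (fun _ hi => tailSymm_mul_natT hi) hv
      change ψ (D v) ∈ _
      rw [hψD, embedding_eq hτ hψ hmul v.2, mul_smul_comm, smul_comm ((τ : ℂ)⁻¹ ^ 2), ← smul_sub,
        ← mul_assoc, ← smul_mul_assoc, ← sub_mul, hZ, smul_mul_assoc, hc]
      exact Submodule.smul_mem _ _ (Submodule.smul_mem _ _ (Submodule.smul_mem _ _
        (Submodule.mem_span_singleton_self s)))
    · rw [Submodule.span_singleton_le_iff_mem]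
      -- The preimage of e itself is an invariant vector that is mapped to a nonzero multiple of s.
      obtain ⟨v, hv⟩ := (hrange _).1 (tailSymm_mem (n := n) (q := 1) (τ := τ))
      have hvi : v ∈ M.inv := (mem_inv_iff hψ hmul).2 fun i hi => by
        rw [hv, natT_mul_tailSymm hτ hi]
      have h1 : (ψ ∘ₗ M.inv.subtype) (D ⟨v, hvi⟩) = ((τ : ℂ)⁻¹ * (τ - (τ : ℂ)⁻¹)) • s := by
        rw [← hZ, ← hv]
        exact hψD ⟨v, hvi⟩
      have h2 := Submodule.smul_mem _ ((τ : ℂ)⁻¹ * (τ - (τ : ℂ)⁻¹))⁻¹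
        (Submodule.mem_map_of_mem (f := ψ ∘ₗ M.inv.subtype) (LinearMap.mem_range_self D ⟨v, hvi⟩))
      rwa [h1, smul_smul, inv_mul_cancel₀ hκ, one_smul] at h2
  rw [rankSubScalar, (Submodule.equivMapOfInjective _ hj (LinearMap.range D)).finrank_eq, hrng,
    finrank_span_singleton hs0]

theorem rankSubScalar_commutator_inv [NeZero n] (hτ : ∀ k : ℕ, 0 < k → (τ : ℂ) ^ k ≠ 1)
    (M : RegularIrrep.{u} n τ) :
    rankSubScalar (M.Xbar * M.Ybar * M.Xbar⁻¹ * M.Ybar⁻¹) ((τ : ℂ) ^ 2) = 1 := by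
  rw [← rankSubScalar_commutator hτ M, ← rankSubScalar_inv _ (pow_ne_zero 2 τ.ne_zero)]
  congr 1
  group

/-- An isomorphism of modules restricts to the invariants. -/
theorem exists_inv_equiv [NeZero n] {M N : RegularIrrep.{u} n τ} (e : M.V ≃ₗ[Daha n 1 τ] N.V) :
    ∃ f : M.inv ≃ₗ[ℂ] N.inv,
      (∀ v, f (M.Xbar v) = N.Xbar (f v)) ∧ ∀ v, f (M.Ybar v) = N.Ybar (f v) := by
  have key : ∀ {M N : RegularIrrep.{u} n τ} (e : M.V ≃ₗ[Daha n 1 τ] N.V) {v : M.V},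
      v ∈ M.inv → e v ∈ N.inv := by
    intro M N e v hv i hi
    rw [← map_smul, hv i hi]
    exact (e.restrictScalars ℂ).map_smul _ _
  refine ⟨LinearEquiv.ofSubmodules (e.restrictScalars ℂ) M.inv N.inv (le_antisymm ?_ ?_),
    fun v => Subtype.ext (e.map_smul _ _), fun v => Subtype.ext (e.map_smul _ _)⟩
  · rintro _ ⟨v, hv, rfl⟩
    exact key e hv
  · intro w hw
    exact ⟨e.symm w, key e.symm hw, e.apply_symm_apply w⟩

/-- Two operators on the invariants, natural in the module and with commutator of the required rank,
define a unique map to the Calogero–Moser space. -/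
theorem existsUnique_map [NeZero n] (hτ : ∀ k : ℕ, 0 < k → (τ : ℂ) ^ k ≠ 1) {t : ℂˣ}
    (A B : ∀ M : RegularIrrep.{u} n τ, M.inv ≃ₗ[ℂ] M.inv)
    (hrank : ∀ M, rankSubScalar (A M * B M * (A M)⁻¹ * (B M)⁻¹) ((t : ℂ)⁻¹ ^ 2) = 1)
    (hnat : ∀ M N : RegularIrrep.{u} n τ, Nonempty (M.V ≃ₗ[Daha n 1 τ] N.V) →
      ∃ f : M.inv ≃ₗ[ℂ] N.inv, (∀ v, f (A M v) = A N (f v)) ∧ ∀ v, f (B M v) = B N (f v)) :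
    (∀ (M : RegularIrrep.{u} n τ) (b : Module.Basis (Fin n) ℂ M.inv),
        ∃ a : CMQuad n t, a.Represents b (A M) (B M)) ∧
      ∃! Φ : IrrepReg.{u} n τ → CMSpace n t,
        ∀ (M : RegularIrrep.{u} n τ) (b : Module.Basis (Fin n) ℂ M.inv) (a : CMQuad n t),
          a.Represents b (A M) (B M) → Φ M.cls = a.cls := by
  have hex := fun (M : RegularIrrep.{u} n τ) (b : Module.Basis (Fin n) ℂ M.inv) =>
    CMQuad.exists_represents b (A M) (B M) (hrank M)
  have hb : ∀ M : RegularIrrep.{u} n τ, ∃ (b : Module.Basis (Fin n) ℂ M.inv) (a : CMQuad n t),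
      a.Represents b (A M) (B M) := fun M => by
    have := M.finite
    let b := Module.finBasisOfFinrankEq ℂ M.inv (M.finrank_inv hτ)
    exact ⟨b, hex M b⟩
  choose b a ha using hb
  -- The map is built from arbitrarily chosen bases and points; `cls_eq_of_represents` makes the
  -- choices irrelevant.
  refine ⟨hex, Quotient.lift (fun M => (a M).cls) ?_, ?_, ?_⟩
  · intro M N hMN
    obtain ⟨f, hA, hB⟩ := hnat M N hMN
    exact CMQuad.cls_eq_of_represents (hrank N) ((ha M).map f hA hB) (ha N)
  · intro M b' a' ha'
    exact CMQuad.cls_eq_of_represents (hrank M) (ha M) ha'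
  · intro Ψ hΨ
    funext x
    induction x using Quotient.inductionOn with
    | h M => exact hΨ M (b M) (a M) (ha M)

end RegularIrrep

theorem mainTheorem7 (n : ℕ) [NeZero n] (τ : ℂˣ) (hτ : ∀ k : ℕ, 0 < k → τ ^ k ≠ 1) :
    -- the commutator identity in `H_{1,τ}`, in both forms
    ((Daha.Y₁ * Daha.X₁ * Daha.Y₁⁻¹ * Daha.X₁⁻¹ : (Daha n 1 τ)ˣ) = Daha.Z ∧
      (Daha.X₁ * Daha.Y₁ * Daha.X₁⁻¹ * Daha.Y₁⁻¹ : (Daha n 1 τ)ˣ) = Daha.Z⁻¹) ∧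
    -- the invariants have dimension `n`, and the rank equations hold
    (∀ M : RegularIrrep.{u} n τ,
      Module.finrank ℂ M.inv = n ∧
      rankSubScalar (M.Ybar * M.Xbar * M.Ybar⁻¹ * M.Xbar⁻¹) ((τ : ℂ)⁻¹ ^ 2) = 1 ∧
      rankSubScalar (M.Xbar * M.Ybar * M.Xbar⁻¹ * M.Ybar⁻¹) ((τ : ℂ) ^ 2) = 1) ∧
    -- `M ↦ (Ȳ₁, X̄₁)` is a well defined map to `CM_τ`
    ((∀ (M : RegularIrrep.{u} n τ) (b : Module.Basis (Fin n) ℂ M.inv),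
        ∃ a : CMQuad n τ, a.Represents b M.Ybar M.Xbar) ∧
      ∃! Φ : IrrepReg.{u} n τ → CMSpace n τ,
        ∀ (M : RegularIrrep.{u} n τ) (b : Module.Basis (Fin n) ℂ M.inv) (a : CMQuad n τ),
          a.Represents b M.Ybar M.Xbar → Φ M.cls = a.cls) ∧
    -- `M ↦ (X̄₁, Ȳ₁)` is a well defined map to `CM_{τ⁻¹}`
    ((∀ (M : RegularIrrep.{u} n τ) (b : Module.Basis (Fin n) ℂ M.inv),
        ∃ a : CMQuad n τ⁻¹, a.Represents b M.Xbar M.Ybar) ∧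
      ∃! Φ : IrrepReg.{u} n τ → CMSpace n τ⁻¹,
        ∀ (M : RegularIrrep.{u} n τ) (b : Module.Basis (Fin n) ℂ M.inv) (a : CMQuad n τ⁻¹),
          a.Represents b M.Xbar M.Ybar → Φ M.cls = a.cls) := by
  have hτ' : ∀ k : ℕ, 0 < k → (τ : ℂ) ^ k ≠ 1 := fun k hk h => hτ k hk (Units.ext (by simpa using h))
  refine ⟨⟨Daha.Y₁_commutator_X₁, Daha.X₁_commutator_Y₁⟩, fun M => ⟨M.finrank_inv hτ',
    M.rankSubScalar_commutator hτ', M.rankSubScalar_commutator_inv hτ'⟩, ?_, ?_⟩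
  · refine RegularIrrep.existsUnique_map hτ' (fun M => M.Ybar) (fun M => M.Xbar)
      (fun M => M.rankSubScalar_commutator hτ') fun M N ⟨e⟩ => ?_
    obtain ⟨f, hX, hY⟩ := RegularIrrep.exists_inv_equiv e
    exact ⟨f, hY, hX⟩
  · refine RegularIrrep.existsUnique_map hτ' (fun M => M.Xbar) (fun M => M.Ybar) (fun M => ?_)
      fun M N ⟨e⟩ => RegularIrrep.exists_inv_equiv e
    -- For t = τ⁻¹ the scalar t⁻² is τ².
    simpa using M.rankSubScalar_commutator_inv hτ'
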